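/- Theorem (sparse Hamiltonian learning via pure-state tomography). For $x=(a,b)\in\{0,1\}^{2n}$ let $P_x=\bigotimes_{k} i^{a_kb_k}X^{a_k}Z^{b_k}$ be the $n$-qubit Pauli operators ($P_0=I$). For an operator $A=\sum_x\alpha_xP_x$ write $\operatorname{supp}_P(A)=|\{x:\alpha_x\ne0\}|$ and $\|A\|_{\ell_\infty}=\max_x|\alpha_x|$. Let $|\Phi\rangle=2^{-n/2}\sum_i|i\rangle|i\rangle$ be the maximally entangled state of two $n$-qubit registers, let $V$ be the unitary with $V(P_x\otimes I)|\Phi\rangle=|x\rangle$ for all $x$, and put $|\psi_t\rangle=V(e^{-iAt}\otimes I)|\Phi\rangle=\sum_x\beta_x|x\rangle$; one copy of $|\psi_t\rangle$ uses one query to $e^{-iAt}$, of duration $t$. There is a universal constant $C>0$ such that for all integers $n\ge 0$, $m\ge1$ and all reals $\varepsilon>0$, $\delta\in(0,1)$, with $t=1/(32m\varepsilon)=\mathcal{O}(1/(m\varepsilon))$, there are a number of copies $N$ and a pure-state tomography procedure (a measurement, possibly joint, of $|\psi_t\rangle^{\otimes N}$ followed by classical post-processing of its outcome into an estimate $\widetilde\beta$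 of $\beta$), depending only on $n,m,\varepsilon,\delta$, whose total evolution time satisfies $$Nt\;\le\;C\,\frac{m^2}{\varepsilon}\,\log\frac{2m}{\delta}\;=\;\widetilde{\mathcal{O}}\!\left(\frac{m^2}{\varepsilon}\right),$$ and such that for every traceless Hermitian $n$-qubit operator $A$ with $\operatorname{supp}_P(A)\le m$ and $\|A\|_{\ell_\infty}\le\varepsilon$ the following hold simultaneously with probability at least $1-\delta$: the tomography is accurate in $\ell_\infty$, $\max_x|\widetilde\beta_x-\beta_x|\le 3mt^2\varepsilon^2$; and $A_1:=\sum_{x\ne0}\bigl(-\operatorname{Im}\widetilde\beta_x/t\bigr)P_x$ is an $m$-sparse traceless Hermitian operator (i.e. $\operatorname{supp}_P(A_1)\le m$) with $\|A-A_1\|_{\ell_\infty}\le\varepsilon/8$. -/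

import Mathlib

open scoped Kronecker Matrix ComplexOrder

noncomputable section

/-- Computational-basis labels of an `n`-qubit register. -/
abbrev Qubits (n : ℕ) : Type := Fin n → Fin 2

/-- Labels `x = (a, b) ∈ {0,1}^{2n}` of the `n`-qubit Pauli operators, grouped qubit by qubit. -/
abbrev PauliLabel (n : ℕ) : Type := Fin n → Bool × Bool

/-- The single-qubit Pauli matrix `i^{ab} X^a Z^b`:
`(0,0) ↦ I`, `(1,0) ↦ X`, `(0,1) ↦ Z`, `(1,1) ↦ Y`. -/
def singlePauli : Bool × Bool → Matrix (Fin 2) (Fin 2) ℂ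
  | (false, false) => !![1, 0; 0, 1]
  | (true, false) => !![0, 1; 1, 0]
  | (false, true) => !![1, 0; 0, -1]
  | (true, true) => !![0, -Complex.I; Complex.I, 0]

/-- The `n`-qubit Pauli operator `P_x`, the tensor product of single-qubit Pauli matrices. -/
def pauli {n : ℕ} (x : PauliLabel n) : Matrix (Qubits n) (Qubits n) ℂ :=
  Matrix.of fun i j => ∏ k, singlePauli (x k) (i k) (j k)

/-- The label of the identity, `P_0 = I`. -/
def zeroLabel (n : ℕ) : PauliLabel n := fun _ => (false, false)

/-- The Pauli coefficient `α_x = 2^{-n} Tr(P_x A)` of `A = ∑ x, α_x P_x`. -/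
def pauliCoeff {n : ℕ} (A : Matrix (Qubits n) (Qubits n) ℂ) (x : PauliLabel n) : ℂ :=
  (pauli x * A).trace / 2 ^ n

/-- The Pauli sparsity of `A`: the number of nonzero Pauli coefficients. -/
def pauliSparsity {n : ℕ} (A : Matrix (Qubits n) (Qubits n) ℂ) : ℕ :=
  {x : PauliLabel n | pauliCoeff A x ≠ 0}.ncard

/-- The norm `‖A‖_{ℓ∞} = max_x |α_x|` of the Pauli coefficients. -/
def pauliNormInf {n : ℕ} (A : Matrix (Qubits n) (Qubits n) ℂ) : ℝ :=
  Finset.univ.sup' ⟨zeroLabel n, Finset.mem_univ _⟩ fun x => ‖pauliCoeff A x‖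

/-- The maximally entangled state `|Φ⟩ = 2^{-n/2} ∑ i, |i⟩|i⟩` of two `n`-qubit registers. -/
def maxEntangled (n : ℕ) : Qubits n × Qubits n → ℂ :=
  fun p => if p.1 = p.2 then ((Real.sqrt (2 ^ n))⁻¹ : ℝ) else 0

/-- The state `(P_x ⊗ I)|Φ⟩`. -/
def bellState {n : ℕ} (x : PauliLabel n) : Qubits n × Qubits n → ℂ :=
  (pauli x ⊗ₖ (1 : Matrix (Qubits n) (Qubits n) ℂ)) *ᵥ maxEntangled n

/-- The Bell-basis decoder `V = ∑ x, |x⟩⟨Φ_x|` with `|Φ_x⟩ = (P_x ⊗ I)|Φ⟩`. It is the unitary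
determined by `V (P_x ⊗ I)|Φ⟩ = |x⟩`; see `bellDecoder_mulVec_bellState` and
`bellDecoder_mul_conjTranspose`, `bellDecoder_conjTranspose_mul`. -/
def bellDecoder (n : ℕ) : Matrix (PauliLabel n) (Qubits n × Qubits n) ℂ :=
  Matrix.of fun x p => star (bellState x p)

theorem singlePauli_orthogonal (p q : Bool × Bool) :
    ∑ a, ∑ b, star (singlePauli p a b) * singlePauli q a b = if p = q then (2 : ℂ) else 0 := by
  obtain ⟨p1, p2⟩ := p
  obtain ⟨q1, q2⟩ := q
  cases p1 <;> cases p2 <;> cases q1 <;> cases q2 <;>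
    simp [singlePauli, Fin.sum_univ_two] <;> norm_num

theorem pauli_orthogonal {n : ℕ} (x y : PauliLabel n) :
    ∑ i, ∑ j, star (pauli x i j) * pauli y i j = if x = y then (2 : ℂ) ^ n else 0 := by
  have h1 : ∀ i j : Qubits n, star (pauli x i j) * pauli y i j
      = ∏ k, (star (singlePauli (x k) (i k) (j k)) * singlePauli (y k) (i k) (j k)) := by
    intro i j
    simp [pauli, Finset.prod_mul_distrib]
  have h2 : ∑ i : Qubits n, ∑ j : Qubits n, star (pauli x i j) * pauli y i j
      = ∏ k, ∑ a, ∑ b, star (singlePauli (x k) a b) * singlePauli (y k) a b := by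
    simp_rw [h1]
    rw [Finset.prod_univ_sum]
    simp only [Fintype.piFinset_univ]
    refine Finset.sum_congr rfl fun i _ => ?_
    rw [Finset.prod_univ_sum]
    simp only [Fintype.piFinset_univ]
  rw [h2]
  simp_rw [singlePauli_orthogonal]
  split_ifs with h
  · subst h
    simp
  · obtain ⟨k, hk⟩ := Function.ne_iff.mp h
    exact Finset.prod_eq_zero (Finset.mem_univ k) (by simp [hk])

theorem bellState_apply {n : ℕ} (x : PauliLabel n) (p : Qubits n × Qubits n) :
    bellState x p = pauli x p.1 p.2 * ((Real.sqrt (2 ^ n))⁻¹ : ℝ) := by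
  obtain ⟨i, j⟩ := p
  simp only [bellState, Matrix.mulVec, dotProduct, Fintype.sum_prod_type, maxEntangled,
    Matrix.kroneckerMap_apply, Matrix.one_apply]
  simp

theorem bellDecoder_mul_conjTranspose (n : ℕ) : bellDecoder n * (bellDecoder n)ᴴ = 1 := by
  ext x y
  have hs : ((Real.sqrt (2 ^ n))⁻¹ : ℝ) * ((Real.sqrt (2 ^ n))⁻¹ : ℝ) = ((2 : ℝ) ^ n)⁻¹ := by
    rw [← mul_inv, Real.mul_self_sqrt (by positivity)]
  have hs' : (((Real.sqrt (2 ^ n))⁻¹ : ℝ) : ℂ) * (((Real.sqrt (2 ^ n))⁻¹ : ℝ) : ℂ)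
      = ((2 : ℂ) ^ n)⁻¹ := by
    rw [← Complex.ofReal_mul, hs]
    push_cast
    rfl
  have key : (bellDecoder n * (bellDecoder n)ᴴ) x y
      = ((2 : ℂ) ^ n)⁻¹ * ∑ i, ∑ j, star (pauli x i j) * pauli y i j := by
    rw [← hs', Matrix.mul_apply, Fintype.sum_prod_type, Finset.mul_sum]
    refine Finset.sum_congr rfl fun i _ => ?_
    rw [Finset.mul_sum]
    refine Finset.sum_congr rfl fun j _ => ?_
    simp only [bellDecoder, Matrix.conjTranspose_apply, Matrix.of_apply,
      bellState_apply, star_mul', Complex.star_def, Complex.conj_ofReal, Complex.conj_conj]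
    ring
  rw [key, pauli_orthogonal, Matrix.one_apply]
  split_ifs <;> simp

theorem bellDecoder_conjTranspose_mul (n : ℕ) : (bellDecoder n)ᴴ * bellDecoder n = 1 := by
  refine (Matrix.mul_eq_one_comm_of_card_eq _ _ _ ?_).mp (bellDecoder_mul_conjTranspose n)
  simp [← mul_pow]

theorem bellDecoder_mulVec_bellState {n : ℕ} (x : PauliLabel n) :
    bellDecoder n *ᵥ bellState x = Pi.single x 1 := by
  ext y
  have h := congrFun (congrFun (bellDecoder_mul_conjTranspose n) y) x
  rw [Matrix.mul_apply] at h
  simp only [Matrix.mulVec, dotProduct]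
  simp only [bellDecoder, Matrix.conjTranspose_apply, Matrix.of_apply, star_star] at h ⊢
  rw [h, Matrix.one_apply, Pi.single_apply]

/-- The time evolution operator `e^{-iAt}`. -/
def timeEvolution {n : ℕ} (A : Matrix (Qubits n) (Qubits n) ℂ) (t : ℝ) :
    Matrix (Qubits n) (Qubits n) ℂ :=
  NormedSpace.exp ((-(Complex.I * (t : ℂ))) • A)

/-- The state `|ψ_t⟩ = V (e^{-iAt} ⊗ I)|Φ⟩`: a single query to `e^{-iAt}` is applied to one half
of the maximally entangled state, and the result is decoded. -/
def evolvedState {n : ℕ} (A : Matrix (Qubits n) (Qubits n) ℂ) (t : ℝ) : PauliLabel n → ℂ :=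
  bellDecoder n *ᵥ
    ((timeEvolution A t ⊗ₖ (1 : Matrix (Qubits n) (Qubits n) ℂ)) *ᵥ maxEntangled n)

/-- A (generalized) quantum measurement, i.e. a POVM with finitely many outcomes, on the Hilbert
space with orthonormal basis `ι`. -/
structure POVM (ι Ω : Type) [Fintype ι] [DecidableEq ι] [Fintype Ω] where
  effect : Ω → Matrix ι ι ℂ
  posSemidef : ∀ ω, (effect ω).PosSemidef
  sum_eq_one : ∑ ω, effect ω = 1

/-- The Born probability `⟨φ|E_ω|φ⟩` of the outcome `ω` in the pure state `φ`. -/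
def POVM.bornProb {ι Ω : Type} [Fintype ι] [DecidableEq ι] [Fintype Ω]
    (M : POVM ι Ω) (φ : ι → ℂ) (ω : Ω) : ℝ :=
  (star φ ⬝ᵥ (M.effect ω *ᵥ φ)).re

/-- The state `φ^{⊗ N}`, consisting of `N` copies of `φ`. -/
def copies {ι : Type} (N : ℕ) (φ : ι → ℂ) : (Fin N → ι) → ℂ :=
  fun y => ∏ k, φ (y k)

/-- A procedure that learns an unknown `n`-qubit Hamiltonian `A` from `numCopies` copies of
`|ψ_t⟩ = V (e^{-iAt} ⊗ I)|Φ⟩`, each prepared by one query to `e^{-iAt}`, by pure-state tomography.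
A measurement of the copies (in general a joint one: it subsumes internal randomness, ancillas and
the adaptive measurement of single copies), which cannot depend on `A`, is followed by classical
post-processing of its outcome into an estimate of the amplitude vector of `|ψ_t⟩`. -/
structure TomographyLearner (n : ℕ) where
  time : ℝ
  time_pos : 0 < time
  numCopies : ℕ
  Outcome : Type
  [fintypeOutcome : Fintype Outcome]
  measurement : POVM (Fin numCopies → PauliLabel n) Outcome
  amplitudes : Outcome → PauliLabel n → ℂ

namespace TomographyLearner

attribute [instance] TomographyLearner.fintypeOutcome

variable {n : ℕ}

/-- The total evolution time: the sum of the evolution times of all queries. -/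
def totalEvolutionTime (L : TomographyLearner n) : ℝ :=
  ∑ _k : Fin L.numCopies, L.time

/-- The probability that the outcome lies in `S` when the unknown Hamiltonian is `A`. -/
def prob (L : TomographyLearner n) (A : Matrix (Qubits n) (Qubits n) ℂ)
    (S : Set L.Outcome) : ℝ :=
  ∑ ω, S.indicator (L.measurement.bornProb (copies L.numCopies (evolvedState A L.time))) ω

/-- The Hamiltonian `A₁ = ∑_{x ≠ 0} (- Im β̃_x / t) P_x` read off from the estimate `β̃` of the
amplitudes, which to first order in `t` are `β_0 ≈ 1` and `β_x ≈ - i t α_x`. -/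
def estimate (L : TomographyLearner n) (ω : L.Outcome) : Matrix (Qubits n) (Qubits n) ℂ :=
  ∑ x ∈ Finset.univ.erase (zeroLabel n),
    ((-(L.amplitudes ω x).im / L.time : ℝ) : ℂ) • pauli x

end TomographyLearner

end

noncomputable section

/-! Decoding turns the amplitudes of `|ψ_t⟩` into the Pauli coefficients of `e^{-iAt}`. Products of
Paulis are Paulis up to a phase, so multiplying by `A` scales the largest coefficient by at most the
ℓ¹ norm of the coefficients of `A`, which is at most `mε`. Hence `A ^ (k + 1)` has coefficients at
most `(mε)^k ε`. With `tmε = 1/32` and `r = mt²ε² = 1/(1024m)`, the exponential series gives `β_x =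
[x = 0] - i t α_x` up to `0.6 r` (`norm_evolvedState_sub_le`).

It remains to estimate the amplitudes to order `r` with a number of copies independent of `n`. Half
of the copies are measured in the computational basis: with about `r⁻²` samples, up to a logarithm,
every support label with `|β_x| ≥ r` is seen. The other half are measured in a tight frame of
vectors of fourth roots of unity; by orthogonality of characters, `Im (w_x conj w_0)` has mean `Im
(β_x conj β_0)`, and this is close to `Im β_x` because `β_0 ≈ 1`. The means only have to be good at
labels that were seen. As the two halves are independent, the union bound costs the expected number
of seen labels, at most `N`, instead of `4 ^ n` (`weight_two_stage_le`).

Finally, estimates at most `3r/2` are set to zero. A label with `α_x = 0` never passes this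
threshold, which gives sparsity, and the other errors stay within `3r`
(`thresholdLearner_accurate`). -/

/-! ### Pauli algebra and the Pauli expansion -/

theorem star_singlePauli (p : Bool × Bool) (a b : Fin 2) :
    star (singlePauli p a b) = singlePauli p b a := by
  obtain ⟨p1, p2⟩ := p
  cases p1 <;> cases p2 <;> fin_cases a <;> fin_cases b <;> simp [singlePauli]

theorem singlePauli_mul (p q : Bool × Bool) :
    ∃ (c : ℂ) (r : Bool × Bool), ‖c‖ = 1 ∧ singlePauli p * singlePauli q = c • singlePauli r := by
  obtain ⟨p1, p2⟩ := p
  obtain ⟨q1, q2⟩ := q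
  -- The phase is `-i` for `XZ`, `YX`, `ZY`, it is `i` for the reversed products, and `1` otherwise;
  -- labels add modulo 2.
  refine ⟨if (p1 && q2 && !p2 && !q1) || (p1 && p2 && q1 && !q2) || (!p1 && p2 && q1 && q2)
      then -Complex.I
    else if (p2 && q1 && !p1 && !q2) || (p1 && q1 && q2 && !p2) || (!q1 && p1 && p2 && q2)
      then Complex.I else 1, (xor p1 q1, xor p2 q2), ?_, ?_⟩
  · split_ifs <;> simp
  · cases p1 <;> cases p2 <;> cases q1 <;> cases q2 <;> ext i j <;> fin_cases i <;>
      fin_cases j <;> simp [singlePauli, Matrix.mul_apply]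

theorem star_pauli {n : ℕ} (x : PauliLabel n) (i j : Qubits n) :
    star (pauli x i j) = pauli x j i := by
  simp only [pauli, Matrix.of_apply, star_prod, star_singlePauli]

theorem pauli_isHermitian {n : ℕ} (x : PauliLabel n) : (pauli x).IsHermitian :=
  Matrix.IsHermitian.ext fun i j => star_pauli x j i

theorem pauli_mul {n : ℕ} (x y : PauliLabel n) :
    ∃ (c : ℂ) (z : PauliLabel n), ‖c‖ = 1 ∧ pauli x * pauli y = c • pauli z := by
  choose c r hc h using fun k => singlePauli_mul (x k) (y k)
  refine ⟨∏ k, c k, r, by simp [hc], ?_⟩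
  ext i j
  simp only [pauli, Matrix.mul_apply, Matrix.of_apply, Matrix.smul_apply, smul_eq_mul,
    ← Finset.prod_mul_distrib]
  have h1 := Finset.prod_univ_sum (fun _ : Fin n => (Finset.univ : Finset (Fin 2)))
    (fun k a => singlePauli (x k) (i k) a * singlePauli (y k) a (j k))
  rw [Fintype.piFinset_univ] at h1
  rw [← h1]
  refine Finset.prod_congr rfl fun k _ => ?_
  simpa [Matrix.mul_apply] using congrFun (congrFun (h k) (i k)) (j k)

theorem pauli_zeroLabel (n : ℕ) : pauli (zeroLabel n) = 1 := by
  ext i j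
  have h : ∀ a b : Fin 2, singlePauli (false, false) a b = if a = b then 1 else 0 := by
    intro a b
    fin_cases a <;> fin_cases b <;> simp [singlePauli]
  simp only [pauli, zeroLabel, Matrix.of_apply, h, Matrix.one_apply, Finset.prod_ite_zero,
    Finset.mem_univ, true_implies, Finset.prod_const_one, funext_iff]

theorem pauliCoeff_eq_sum {n : ℕ} (A : Matrix (Qubits n) (Qubits n) ℂ) (x : PauliLabel n) :
    pauliCoeff A x = (∑ i, ∑ j, star (pauli x i j) * A i j) / 2 ^ n := by
  simp only [pauliCoeff, Matrix.trace, Matrix.diag, Matrix.mul_apply, star_pauli]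
  rw [Finset.sum_comm]

theorem pauliCoeff_pauli {n : ℕ} (x y : PauliLabel n) :
    pauliCoeff (pauli y) x = if x = y then 1 else 0 := by
  rw [pauliCoeff_eq_sum, pauli_orthogonal]
  split_ifs <;> simp

theorem pauliCoeff_add {n : ℕ} (A B : Matrix (Qubits n) (Qubits n) ℂ) (x : PauliLabel n) :
    pauliCoeff (A + B) x = pauliCoeff A x + pauliCoeff B x := by
  simp [pauliCoeff, mul_add, add_div]

theorem pauliCoeff_sub {n : ℕ} (A B : Matrix (Qubits n) (Qubits n) ℂ) (x : PauliLabel n) :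
    pauliCoeff (A - B) x = pauliCoeff A x - pauliCoeff B x := by
  simp [pauliCoeff, mul_sub, sub_div]

theorem pauliCoeff_smul {n : ℕ} (c : ℂ) (A : Matrix (Qubits n) (Qubits n) ℂ)
    (x : PauliLabel n) : pauliCoeff (c • A) x = c * pauliCoeff A x := by
  simp [pauliCoeff, mul_div_assoc]

/-- The Pauli coefficient as a linear functional. -/
def pauliCoeffHom {n : ℕ} (x : PauliLabel n) : Matrix (Qubits n) (Qubits n) ℂ →ₗ[ℂ] ℂ where
  toFun A := pauliCoeff A x
  map_add' A B := pauliCoeff_add A B x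
  map_smul' c A := pauliCoeff_smul c A x

theorem pauliCoeff_sum {n : ℕ} {κ : Type*} (s : Finset κ)
    (F : κ → Matrix (Qubits n) (Qubits n) ℂ) (x : PauliLabel n) :
    pauliCoeff (∑ k ∈ s, F k) x = ∑ k ∈ s, pauliCoeff (F k) x :=
  map_sum (pauliCoeffHom x) F s

/-- Completeness of the Paulis is the identity `Vᴴ V = 1` for the Bell decoder, read entrywise. -/
theorem sum_pauliCoeff_smul {n : ℕ} (A : Matrix (Qubits n) (Qubits n) ℂ) :
    ∑ x, pauliCoeff A x • pauli x = A := by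
  have hs : (((Real.sqrt (2 ^ n))⁻¹ : ℝ) : ℂ) * (((Real.sqrt (2 ^ n))⁻¹ : ℝ) : ℂ)
      = ((2 : ℂ) ^ n)⁻¹ := by
    rw [← Complex.ofReal_mul, ← mul_inv, Real.mul_self_sqrt (by positivity)]
    push_cast
    rfl
  have hV : ∀ p q : Qubits n × Qubits n, ∑ x, pauli x p.1 p.2 * star (pauli x q.1 q.2) / 2 ^ n
      = if p = q then 1 else 0 := by
    intro p q
    have h := congrFun (congrFun (bellDecoder_conjTranspose_mul n) p) q
    rw [Matrix.mul_apply, Matrix.one_apply] at h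
    rw [← h]
    refine Finset.sum_congr rfl fun x _ => ?_
    simp only [bellDecoder, Matrix.conjTranspose_apply, Matrix.of_apply, bellState_apply,
      star_mul', Complex.star_def, Complex.conj_ofReal, Complex.conj_conj]
    rw [div_eq_mul_inv, ← hs]
    ring
  ext i j
  simp only [Matrix.sum_apply, Matrix.smul_apply, smul_eq_mul, pauliCoeff_eq_sum]
  calc _ = ∑ x, ∑ q : Qubits n × Qubits n,
        pauli x i j * star (pauli x q.1 q.2) / 2 ^ n * A q.1 q.2 := by
        refine Finset.sum_congr rfl fun x _ => ?_
        rw [← Fintype.sum_prod_type' (fun k l => star (pauli x k l) * A k l), Finset.sum_div,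
          Finset.sum_mul]
        exact Finset.sum_congr rfl fun q _ => by ring
    _ = ∑ q : Qubits n × Qubits n, (if (i, j) = q then 1 else 0) * A q.1 q.2 := by
        rw [Finset.sum_comm]
        refine Finset.sum_congr rfl fun q _ => ?_
        rw [← hV, Finset.sum_mul]
    _ = A i j := by simp

/-! ### Short-time expansion of the amplitudes -/

/-- Both sides are linear in the evolution operator, and the decoder sends the Bell state of `P_y`
to `|y⟩`. -/
theorem evolvedState_eq_pauliCoeff {n : ℕ} (A : Matrix (Qubits n) (Qubits n) ℂ) (t : ℝ)
    (x : PauliLabel n) : evolvedState A t x = pauliCoeff (timeEvolution A t) x := by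
  have hV : timeEvolution A t = ∑ y, pauliCoeff (timeEvolution A t) y • pauli y :=
    (sum_pauliCoeff_smul _).symm
  have h1 : (timeEvolution A t ⊗ₖ (1 : Matrix (Qubits n) (Qubits n) ℂ)) *ᵥ maxEntangled n
      = ∑ y, pauliCoeff (timeEvolution A t) y • bellState y := by
    conv_lhs => rw [hV]
    ext p
    simp only [bellState, Matrix.mulVec, dotProduct, Matrix.kroneckerMap_apply, Matrix.sum_apply,
      Matrix.smul_apply, Finset.sum_apply, Pi.smul_apply, smul_eq_mul, Finset.sum_mul,
      Finset.mul_sum]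
    rw [Finset.sum_comm]
    exact Finset.sum_congr rfl fun y _ => Finset.sum_congr rfl fun q _ => by ring
  rw [evolvedState, h1, Matrix.mulVec_sum]
  simp [Matrix.mulVec_smul, bellDecoder_mulVec_bellState, Pi.single_apply]

/-- A Young inequality of type ℓ¹–ℓ^∞: multiplication by a single Pauli permutes the coefficients of
`B` up to phases. -/
theorem norm_pauliCoeff_mul_le {n : ℕ} (A B : Matrix (Qubits n) (Qubits n) ℂ) {b : ℝ}
    (hb : ∀ x, ‖pauliCoeff B x‖ ≤ b) (x : PauliLabel n) :
    ‖pauliCoeff (A * B) x‖ ≤ (∑ y, ‖pauliCoeff A y‖) * b := by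
  have h : pauliCoeff (A * B) x = ∑ y, pauliCoeff A y * pauliCoeff (pauli y * B) x := by
    conv_lhs => rw [← sum_pauliCoeff_smul A]
    rw [Finset.sum_mul, pauliCoeff_sum]
    simp [pauliCoeff_smul]
  rw [h, Finset.sum_mul]
  refine (norm_sum_le _ _).trans (Finset.sum_le_sum fun y _ => ?_)
  rw [norm_mul]
  refine mul_le_mul_of_nonneg_left ?_ (norm_nonneg _)
  obtain ⟨c, z, hc, hz⟩ := pauli_mul x y
  have h2 : pauliCoeff (pauli y * B) x = c * pauliCoeff B z := by
    simp [pauliCoeff, ← mul_assoc, hz, mul_div_assoc]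
  rw [h2, norm_mul, hc, one_mul]
  exact hb z

theorem norm_pauliCoeff_le_pauliNormInf {n : ℕ} (A : Matrix (Qubits n) (Qubits n) ℂ)
    (x : PauliLabel n) : ‖pauliCoeff A x‖ ≤ pauliNormInf A :=
  Finset.le_sup' (fun x => ‖pauliCoeff A x‖) (Finset.mem_univ x)

theorem sum_norm_pauliCoeff_le {n m : ℕ} {ε : ℝ} (hε : 0 ≤ ε)
    (A : Matrix (Qubits n) (Qubits n) ℂ)
    (hm : pauliSparsity A ≤ m) (hA : pauliNormInf A ≤ ε) :
    ∑ x, ‖pauliCoeff A x‖ ≤ m * ε := by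
  classical
  have h1 : ∑ x, ‖pauliCoeff A x‖
      = ∑ x ∈ Finset.univ.filter (fun x => pauliCoeff A x ≠ 0), ‖pauliCoeff A x‖ := by
    rw [Finset.sum_filter]
    exact Finset.sum_congr rfl fun x _ => by split_ifs with h <;> simp_all
  have h2 : (Finset.univ.filter (fun x => pauliCoeff A x ≠ 0)).card ≤ m := by
    rw [pauliSparsity, Set.ncard_eq_toFinset_card'] at hm
    simpa using hm
  rw [h1]
  refine (Finset.sum_le_card_nsmul _ _ ε
    fun x _ => (norm_pauliCoeff_le_pauliNormInf A x).trans hA).trans ?_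
  rw [nsmul_eq_mul]
  exact mul_le_mul_of_nonneg_right (by exact_mod_cast h2) hε

theorem norm_pauliCoeff_pow_le {n m : ℕ} {ε : ℝ} (hε : 0 ≤ ε)
    (A : Matrix (Qubits n) (Qubits n) ℂ)
    (hm : pauliSparsity A ≤ m) (hA : pauliNormInf A ≤ ε) (k : ℕ) (x : PauliLabel n) :
    ‖pauliCoeff (A ^ (k + 1)) x‖ ≤ (m * ε) ^ k * ε := by
  induction k generalizing x with
  | zero => simpa using (norm_pauliCoeff_le_pauliNormInf A x).trans hA
  | succ k ih =>
    rw [pow_succ']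
    refine (norm_pauliCoeff_mul_le A _ ih x).trans ?_
    rw [pow_succ', mul_assoc]
    exact mul_le_mul_of_nonneg_right (sum_norm_pauliCoeff_le hε A hm hA) (by positivity)

theorem pauliCoeff_im {n : ℕ} {A : Matrix (Qubits n) (Qubits n) ℂ} (hA : A.IsHermitian)
    (x : PauliLabel n) : (pauliCoeff A x).im = 0 := by
  rw [← Complex.conj_eq_iff_im, pauliCoeff, map_div₀, ← Complex.star_def,
    ← Matrix.trace_conjTranspose, Matrix.conjTranspose_mul, hA.eq, (pauli_isHermitian x).eq,
    Matrix.trace_mul_comm]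
  simp

theorem hasSum_pauliCoeff_timeEvolution {n : ℕ} (A : Matrix (Qubits n) (Qubits n) ℂ) (t : ℝ)
    (x : PauliLabel n) :
    HasSum (fun k : ℕ => ((k.factorial : ℂ)⁻¹ * (-(Complex.I * t)) ^ k) * pauliCoeff (A ^ k) x)
      (pauliCoeff (timeEvolution A t) x) := by
  -- The choice of norm is immaterial: it only provides convergence of the exponential series, and
  -- the coefficient functional is continuous in finite dimension.
  let _ : NormedRing (Matrix (Qubits n) (Qubits n) ℂ) := Matrix.linftyOpNormedRing
  let _ : NormedAlgebra ℂ (Matrix (Qubits n) (Qubits n) ℂ) := Matrix.linftyOpNormedAlgebra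
  have h := NormedSpace.exp_series_hasSum_exp' (𝕂 := ℂ) ((-(Complex.I * (t : ℂ))) • A)
  have h2 := h.map (pauliCoeffHom x) (LinearMap.continuous_of_finiteDimensional _)
  refine h2.congr_fun ?_
  intro k
  change _ = pauliCoeff _ x
  rw [pauliCoeff_smul, smul_pow, pauliCoeff_smul, mul_assoc]

theorem norm_evolvedState_sub_le {n m : ℕ} {ε t : ℝ} (hε : 0 ≤ ε) (ht : 0 ≤ t)
    (hs : t * (m * ε) < 1) {A : Matrix (Qubits n) (Qubits n) ℂ}
    (hm : pauliSparsity A ≤ m) (hA : pauliNormInf A ≤ ε) (x : PauliLabel n) :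
    ‖evolvedState A t x -
        ((if x = zeroLabel n then 1 else 0) - Complex.I * t * pauliCoeff A x)‖
      ≤ t * ε * (t * (m * ε)) / 2 * (1 - t * (m * ε))⁻¹ := by
  have h := hasSum_pauliCoeff_timeEvolution A t x
  -- The terms of degree 0 and 1 are split off; the rest is dominated by a geometric series of ratio
  -- `tmε`, using `1/(k+2)! ≤ 1/2`.
  rw [← evolvedState_eq_pauliCoeff, ← hasSum_nat_add_iff' 2] at h
  have h0 : pauliCoeff (1 : Matrix (Qubits n) (Qubits n) ℂ) x
      = if x = zeroLabel n then 1 else 0 := by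
    rw [← pauli_zeroLabel, pauliCoeff_pauli]
  have h1 : ∑ k ∈ Finset.range 2,
      ((k.factorial : ℂ)⁻¹ * (-(Complex.I * t)) ^ k) * pauliCoeff (A ^ k) x
      = (if x = zeroLabel n then 1 else 0) - Complex.I * t * pauliCoeff A x := by
    simp [Finset.sum_range_succ, h0]
    ring
  rw [h1] at h
  have hg : HasSum (fun k : ℕ => t * ε * (t * (m * ε)) / 2 * (t * (m * ε)) ^ k) _ :=
    (hasSum_geometric_of_lt_one (by positivity) hs).mul_left _
  refine h.norm_le_of_bounded hg fun k => ?_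
  have hf : ((k + 2).factorial : ℝ)⁻¹ ≤ 1 / 2 := by
    rw [← one_div]
    refine one_div_le_one_div_of_le two_pos ?_
    exact_mod_cast Nat.factorial_le (show 2 ≤ k + 2 by omega)
  rw [norm_mul, norm_mul, norm_pow, norm_neg, norm_mul, Complex.norm_I, one_mul,
    Complex.norm_real, Real.norm_of_nonneg ht, norm_inv, Complex.norm_natCast]
  calc _ ≤ 1 / 2 * t ^ (k + 2) * ((m * ε) ^ (k + 1) * ε) := by
        gcongr
        exact norm_pauliCoeff_pow_le hε A hm hA (k + 1) x
    _ = _ := by ring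

/-! ### Normalisation of the evolved state -/

theorem timeEvolution_conjTranspose_mul {n : ℕ} {A : Matrix (Qubits n) (Qubits n) ℂ}
    (hA : A.IsHermitian) (t : ℝ) : (timeEvolution A t)ᴴ * timeEvolution A t = 1 := by
  have h : ((-(Complex.I * (t : ℂ))) • A)ᴴ = -((-(Complex.I * (t : ℂ))) • A) := by
    rw [Matrix.conjTranspose_smul, hA.eq]
    simp
  rw [timeEvolution, ← Matrix.exp_conjTranspose, h, Matrix.exp_neg]
  exact Matrix.nonsing_inv_mul _ ((Matrix.isUnit_iff_isUnit_det _).mp (Matrix.isUnit_exp _))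

theorem star_mulVec_dotProduct_mulVec {ι κ : Type*} [Fintype ι] [Fintype κ] [DecidableEq ι]
    {U : Matrix κ ι ℂ} (hU : Uᴴ * U = 1) (v : ι → ℂ) :
    star (U *ᵥ v) ⬝ᵥ (U *ᵥ v) = star v ⬝ᵥ v := by
  rw [Matrix.star_mulVec, ← Matrix.dotProduct_mulVec, Matrix.mulVec_mulVec, hU, Matrix.one_mulVec]

theorem star_maxEntangled_dotProduct (n : ℕ) : star (maxEntangled n) ⬝ᵥ maxEntangled n = 1 := by
  have hs : (((Real.sqrt (2 ^ n))⁻¹ : ℝ) : ℂ) * (((Real.sqrt (2 ^ n))⁻¹ : ℝ) : ℂ)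
      = ((2 : ℂ) ^ n)⁻¹ := by
    rw [← Complex.ofReal_mul, ← mul_inv, Real.mul_self_sqrt (by positivity)]
    push_cast
    rfl
  have h : ∀ p : Qubits n × Qubits n, star (maxEntangled n) p * maxEntangled n p
      = if p.1 = p.2 then ((2 : ℂ) ^ n)⁻¹ else 0 := by
    intro p
    simp only [Pi.star_apply, maxEntangled]
    split_ifs with hp
    · rw [Complex.star_def, Complex.conj_ofReal, hs]
    · simp
  simp only [dotProduct, h, Fintype.sum_prod_type]
  simp

theorem sum_normSq_evolvedState {n : ℕ} {A : Matrix (Qubits n) (Qubits n) ℂ}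
    (hA : A.IsHermitian) (t : ℝ) : ∑ x, ‖evolvedState A t x‖ ^ 2 = 1 := by
  have hU : (timeEvolution A t ⊗ₖ (1 : Matrix (Qubits n) (Qubits n) ℂ))ᴴ *
      (timeEvolution A t ⊗ₖ (1 : Matrix (Qubits n) (Qubits n) ℂ)) = 1 := by
    rw [Matrix.conjTranspose_kronecker, ← Matrix.mul_kronecker_mul,
      timeEvolution_conjTranspose_mul hA]
    simp
  have h : star (evolvedState A t) ⬝ᵥ evolvedState A t = 1 := by
    rw [evolvedState, star_mulVec_dotProduct_mulVec (bellDecoder_conjTranspose_mul n),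
      star_mulVec_dotProduct_mulVec hU, star_maxEntangled_dotProduct]
  have h2 : ∀ x, star (evolvedState A t) x * evolvedState A t x
      = ((‖evolvedState A t x‖ ^ 2 : ℝ) : ℂ) := by
    intro x
    rw [Pi.star_apply, Complex.star_def, Complex.conj_mul']
    push_cast
    rfl
  simp only [dotProduct, h2] at h
  exact_mod_cast h

/-! ### Phase vectors and the unbiased estimator -/

/-- The `X`-indexed vector of fourth roots of unity with exponents `w`. -/
def phaseVec {X : Type*} (w : X → ZMod 4) : X → ℂ := fun x => ZMod.stdAddChar (w x)

theorem star_stdAddChar (j : ZMod 4) :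
    star (ZMod.stdAddChar j : ℂ) = ZMod.stdAddChar (-j) := by
  rw [AddChar.map_neg_eq_conj, Complex.star_def]

theorem sum_stdAddChar_comp {X : Type*} [Fintype X] [DecidableEq X]
    (φ : (X → ZMod 4) →+ ZMod 4) [Decidable (φ = 0)] :
    ∑ w, (ZMod.stdAddChar (φ w) : ℂ)
      = if φ = 0 then (Fintype.card (X → ZMod 4) : ℂ) else 0 := by
  split_ifs with h
  · simp [h]
  · obtain ⟨w, hw⟩ := DFunLike.ne_iff.mp h
    have h2 : (ZMod.stdAddChar (N := 4)).compAddMonoidHom φ ≠ (0 : AddChar _ ℂ) := by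
      intro h3
      have h4 := DFunLike.congr_fun h3 w
      simp only [AddChar.compAddMonoidHom_apply, AddChar.zero_apply] at h4
      exact hw (ZMod.injective_stdAddChar (h4.trans (AddChar.map_zero_eq_one _).symm))
    exact AddChar.sum_eq_zero_iff_ne_zero.mpr h2

theorem sum_phaseVec_mul_star {X : Type*} [Fintype X] [DecidableEq X] (y z : X) :
    ∑ w : X → ZMod 4, phaseVec w y * star (phaseVec w z)
      = if y = z then (Fintype.card (X → ZMod 4) : ℂ) else 0 := by
  classical
  let φ : (X → ZMod 4) →+ ZMod 4 :=
    Pi.evalAddMonoidHom (fun _ : X => ZMod 4) y - Pi.evalAddMonoidHom (fun _ : X => ZMod 4) z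
  have h1 : ∀ w : X → ZMod 4, phaseVec w y * star (phaseVec w z) = ZMod.stdAddChar (φ w) := by
    intro w
    simp only [phaseVec, star_stdAddChar, ← AddChar.map_add_eq_mul]
    simp [φ, sub_eq_add_neg]
  simp_rw [h1, sum_stdAddChar_comp]
  refine if_congr ⟨fun h => ?_, fun h => by simp [φ, h]⟩ rfl rfl
  by_contra hyz
  have := DFunLike.congr_fun h (Pi.single y 1)
  simp only [φ, AddMonoidHom.sub_apply, Pi.evalAddMonoidHom_apply, AddMonoidHom.zero_apply,
    Pi.single_apply, if_true, if_neg (Ne.symm hyz)] at this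
  exact absurd this (by decide)

/-- The summand is a character with exponent `e_z - e_y + e_x - e_o`, so only a vanishing exponent
survives. If `y ≠ x` its entry at `x` is 1 or 2, and if `z ≠ o` its entry at `o` is -1 or -2; these
are nonzero modulo 4. Signs `±1` would not do: modulo 2 the pair `y = o`, `z = x` survives as well.
-/
theorem sum_phaseVec_quadruple {X : Type*} [Fintype X] [DecidableEq X] {o x : X} (hx : x ≠ o)
    (y z : X) :
    ∑ w : X → ZMod 4,
        phaseVec w z * star (phaseVec w y) * (phaseVec w x * star (phaseVec w o))
      = if y = x ∧ z = o then (Fintype.card (X → ZMod 4) : ℂ) else 0 := by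
  classical
  let φ : (X → ZMod 4) →+ ZMod 4 :=
    Pi.evalAddMonoidHom (fun _ : X => ZMod 4) z - Pi.evalAddMonoidHom (fun _ : X => ZMod 4) y +
      (Pi.evalAddMonoidHom (fun _ : X => ZMod 4) x - Pi.evalAddMonoidHom (fun _ : X => ZMod 4) o)
  have h1 : ∀ w : X → ZMod 4,
      phaseVec w z * star (phaseVec w y) * (phaseVec w x * star (phaseVec w o))
        = ZMod.stdAddChar (φ w) := by
    intro w
    simp only [phaseVec, star_stdAddChar, ← AddChar.map_add_eq_mul]
    simp [φ, sub_eq_add_neg]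
  simp_rw [h1, sum_stdAddChar_comp]
  refine if_congr ⟨fun h => ?_, ?_⟩ rfl rfl
  · have hφ : ∀ l, (if z = l then 1 else 0) - (if y = l then 1 else 0) +
        ((if x = l then 1 else 0) - (if o = l then 1 else 0)) = (0 : ZMod 4) := by
      intro l
      have := DFunLike.congr_fun h (Pi.single l 1)
      simpa [φ, Pi.single_apply] using this
    constructor
    · by_contra hyx
      have := hφ x
      simp only [hyx, hx.symm, if_true, if_false] at this
      split_ifs at this <;> revert this <;> decide
    · by_contra hzo
      have := hφ o
      simp only [hzo, hx, if_true, if_false] at this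
      split_ifs at this <;> revert this <;> decide
  · rintro ⟨rfl, rfl⟩
    ext w
    simp [φ]

/-- The probability of the outcome `w` when the pure state `β` is measured with the effects
`4^{-|X|} |w⟩⟨w|` given by the phase vectors. -/
def phaseProb {X : Type*} [Fintype X] [DecidableEq X] (β : X → ℂ) (w : X → ZMod 4) : ℝ :=
  ‖star (phaseVec w) ⬝ᵥ β‖ ^ 2 / Fintype.card (X → ZMod 4)

theorem phaseProb_eq {X : Type*} [Fintype X] [DecidableEq X] (β : X → ℂ) (w : X → ZMod 4) :
    (phaseProb β w : ℂ) = ∑ y, ∑ z, β y * star (β z) *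
      (phaseVec w z * star (phaseVec w y)) / Fintype.card (X → ZMod 4) := by
  have h : (phaseProb β w : ℂ) = (star (phaseVec w) ⬝ᵥ β) * star (star (phaseVec w) ⬝ᵥ β) /
      Fintype.card (X → ZMod 4) := by
    rw [Complex.star_def, Complex.mul_conj', phaseProb]
    push_cast
    rfl
  rw [h]
  simp only [dotProduct, star_sum, Finset.sum_mul_sum, Finset.sum_div, star_mul', Pi.star_apply,
    star_star]
  exact Finset.sum_congr rfl fun y _ => Finset.sum_congr rfl fun z _ => by ring

theorem phaseProb_nonneg {X : Type*} [Fintype X] [DecidableEq X] (β : X → ℂ) (w : X → ZMod 4) :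
    0 ≤ phaseProb β w := by
  unfold phaseProb
  positivity

theorem sum_phaseProb {X : Type*} [Fintype X] [DecidableEq X] {β : X → ℂ}
    (hβ : ∑ x, ‖β x‖ ^ 2 = 1) : ∑ w, phaseProb β w = 1 := by
  have hc : (Fintype.card (X → ZMod 4) : ℂ) ≠ 0 := Nat.cast_ne_zero.mpr Fintype.card_ne_zero
  have h : ((∑ w, phaseProb β w : ℝ) : ℂ) = 1 := by
    push_cast
    simp_rw [phaseProb_eq]
    rw [Finset.sum_comm]
    simp_rw [Finset.sum_comm (s := (Finset.univ : Finset (X → ZMod 4)))]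
    simp_rw [← Finset.sum_div, ← Finset.mul_sum, sum_phaseVec_mul_star]
    simp only [mul_ite, mul_zero, Finset.sum_ite_eq', Finset.mem_univ, if_true]
    rw [← Finset.sum_mul, mul_div_assoc, div_self hc, mul_one]
    simp_rw [Complex.star_def, Complex.mul_conj']
    exact_mod_cast hβ
  exact_mod_cast h

/-- Unbiasedness: after expanding the Born probability, the fourfold orthogonality relation selects
the single term `y = x`, `z = o`. -/
theorem sum_phaseProb_mul {X : Type*} [Fintype X] [DecidableEq X] (β : X → ℂ) {o x : X}
    (hx : x ≠ o) :
    ∑ w, (phaseProb β w : ℂ) * (phaseVec w x * star (phaseVec w o)) = β x * star (β o) := by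
  have hc : (Fintype.card (X → ZMod 4) : ℂ) ≠ 0 := Nat.cast_ne_zero.mpr Fintype.card_ne_zero
  simp_rw [phaseProb_eq, Finset.sum_mul]
  rw [Finset.sum_comm]
  simp_rw [Finset.sum_comm (s := (Finset.univ : Finset (X → ZMod 4)))]
  have h : ∀ y z, ∑ w : X → ZMod 4, β y * star (β z) *
      (phaseVec w z * star (phaseVec w y)) / Fintype.card (X → ZMod 4) *
        (phaseVec w x * star (phaseVec w o))
      = β y * star (β z) * if y = x ∧ z = o then 1 else 0 := by
    intro y z
    have h2 := sum_phaseVec_quadruple hx y z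
    calc _ = β y * star (β z) * ((∑ w : X → ZMod 4,
          phaseVec w z * star (phaseVec w y) * (phaseVec w x * star (phaseVec w o))) /
            Fintype.card (X → ZMod 4)) := by
          rw [Finset.sum_div, Finset.mul_sum]
          exact Finset.sum_congr rfl fun w _ => by ring
      _ = _ := by
          rw [h2]
          split_ifs
          · rw [div_self hc]
          · rw [zero_div]
  simp_rw [h]
  simp [ite_and]

theorem sum_phaseProb_mul_im {X : Type*} [Fintype X] [DecidableEq X] (β : X → ℂ) {o x : X}
    (hx : x ≠ o) :
    ∑ w, phaseProb β w * (phaseVec w x * star (phaseVec w o)).im = (β x * star (β o)).im := by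
  rw [← sum_phaseProb_mul β hx, Complex.im_sum]
  simp

theorem norm_phaseVec {X : Type*} (w : X → ZMod 4) (x : X) : ‖phaseVec w x‖ = 1 := by
  rw [phaseVec, ZMod.stdAddChar_apply]
  exact Circle.norm_coe _

theorem abs_im_phaseVec_le {X : Type*} (w : X → ZMod 4) (x o : X) :
    |(phaseVec w x * star (phaseVec w o)).im| ≤ 1 := by
  refine (Complex.abs_im_le_norm _).trans ?_
  simp [norm_phaseVec]

/-! ### Finite probability: tail bounds and the two-stage scheme -/

/-- The total weight that `p` gives to the elements of `s`. -/
def weight {Ω : Type*} [Fintype Ω] (p : Ω → ℝ) (s : Set Ω) : ℝ := ∑ ω, s.indicator p ω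

section Weight

variable {Ω Ω' : Type*} [Fintype Ω] [Fintype Ω']

theorem weight_mono {p : Ω → ℝ} (hp : ∀ ω, 0 ≤ p ω) {s t : Set Ω} (h : s ⊆ t) :
    weight p s ≤ weight p t :=
  Finset.sum_le_sum fun ω _ => Set.indicator_le_indicator_of_subset h hp ω

theorem weight_add_compl (p : Ω → ℝ) (s : Set Ω) : weight p s + weight p sᶜ = ∑ ω, p ω := by
  rw [weight, weight, ← Finset.sum_add_distrib]
  exact Finset.sum_congr rfl fun ω _ => Set.indicator_self_add_compl_apply s p ω

theorem weight_union_le {p : Ω → ℝ} (hp : ∀ ω, 0 ≤ p ω) (s t : Set Ω) :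
    weight p (s ∪ t) ≤ weight p s + weight p t := by
  classical
  rw [weight, weight, weight, ← Finset.sum_add_distrib]
  refine Finset.sum_le_sum fun ω _ => ?_
  have := hp ω
  by_cases h1 : ω ∈ s <;> by_cases h2 : ω ∈ t <;> simp [h1, h2, this]

theorem weight_biUnion_le {κ : Type*} {p : Ω → ℝ} (hp : ∀ ω, 0 ≤ p ω) (T : Finset κ)
    (s : κ → Set Ω) : weight p (⋃ k ∈ T, s k) ≤ ∑ k ∈ T, weight p (s k) := by
  classical
  induction T using Finset.induction_on with
  | empty => simp [weight]
  | insert k T hk ih =>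
    rw [Finset.sum_insert hk, Finset.set_biUnion_insert]
    exact (weight_union_le hp _ _).trans (by gcongr)

theorem weight_prod (p : Ω → ℝ) (q : Ω' → ℝ) (s : Set Ω) (t : Set Ω') :
    weight (fun z : Ω × Ω' => p z.1 * q z.2) (s ×ˢ t) = weight p s * weight q t := by
  classical
  rw [weight, weight, weight, Finset.sum_mul_sum, Fintype.sum_prod_type]
  refine Finset.sum_congr rfl fun a _ => Finset.sum_congr rfl fun b _ => ?_
  by_cases h1 : a ∈ s <;> by_cases h2 : b ∈ t <;> simp [h1, h2]

theorem sum_pi_prod {R : Type*} [CommSemiring R] {N : ℕ} (f : Fin N → Ω → R) :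
    ∑ a : Fin N → Ω, ∏ k, f k (a k) = ∏ k, ∑ ω, f k ω := by
  classical
  rw [Finset.prod_univ_sum, Fintype.piFinset_univ]

/-- The product distribution of `N` independent samples from `p`. -/
def iidProb {Ω : Type*} (N : ℕ) (p : Ω → ℝ) (a : Fin N → Ω) : ℝ := ∏ k, p (a k)

theorem iidProb_nonneg {Ω : Type*} {N : ℕ} {p : Ω → ℝ} (hp : ∀ ω, 0 ≤ p ω) (a : Fin N → Ω) :
    0 ≤ iidProb N p a :=
  Finset.prod_nonneg fun k _ => hp (a k)

theorem sum_iidProb {N : ℕ} {p : Ω → ℝ} (hp : ∑ ω, p ω = 1) : ∑ a, iidProb N p a = 1 := by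
  simp [iidProb, sum_pi_prod, hp]

theorem weight_iidProb_unseen {N : ℕ} {p : Ω → ℝ} (hp : ∑ ω, p ω = 1) (x : Ω) :
    weight (iidProb N p) {a | ¬ ∃ k, a k = x} = (1 - p x) ^ N := by
  classical
  have h : ∀ a, {a : Fin N → Ω | ¬ ∃ k, a k = x}.indicator (iidProb N p) a
      = ∏ k, (if a k = x then 0 else p (a k)) := by
    intro a
    by_cases ha : ∃ k, a k = x
    · obtain ⟨k, hk⟩ := ha
      rw [Set.indicator_of_notMem (by simpa using ⟨k, hk⟩)]
      exact (Finset.prod_eq_zero (Finset.mem_univ k) (by simp [hk])).symm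
    · rw [Set.indicator_of_mem (by exact ha)]
      push Not at ha
      simp [iidProb, ha]
  rw [weight]
  simp_rw [h]
  rw [sum_pi_prod (fun _ ω => if ω = x then 0 else p ω), Finset.prod_const, Finset.card_univ,
    Fintype.card_fin, ← hp, ← Finset.sum_erase_eq_sub (Finset.mem_univ x)]
  congr 1
  rw [← Finset.sum_erase (a := x) _ (by simp)]
  exact Finset.sum_congr rfl fun ω hω => by simp [Finset.ne_of_mem_erase hω]

theorem weight_iidProb_unseen_le {N : ℕ} {p : Ω → ℝ} (hp0 : ∀ ω, 0 ≤ p ω)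
    (hp : ∑ ω, p ω = 1) (x : Ω) :
    weight (iidProb N p) {a | ¬ ∃ k, a k = x} ≤ Real.exp (-(N * p x)) := by
  have h1 : p x ≤ 1 := hp ▸ Finset.single_le_sum (fun ω _ => hp0 ω) (Finset.mem_univ x)
  rw [weight_iidProb_unseen hp, ← mul_neg, Real.exp_nat_mul]
  exact pow_le_pow_left₀ (by linarith) (by linarith [Real.add_one_le_exp (-p x)]) N

/-- Bernoulli's inequality applied to `(1 - p x) ^ N`. The factor `p x` is what later makes the sum
over all labels harmless. -/
theorem weight_iidProb_seen_le {N : ℕ} {p : Ω → ℝ} (hp0 : ∀ ω, 0 ≤ p ω)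
    (hp : ∑ ω, p ω = 1) (x : Ω) :
    weight (iidProb N p) {a | ∃ k, a k = x} ≤ N * p x := by
  have h1 : p x ≤ 1 := hp ▸ Finset.single_le_sum (fun ω _ => hp0 ω) (Finset.mem_univ x)
  have h2 := weight_add_compl (iidProb N p) {a | ∃ k, a k = x}
  rw [sum_iidProb hp] at h2
  have h3 := weight_iidProb_unseen (N := N) hp x
  have h4 : {a : Fin N → Ω | ∃ k, a k = x}ᶜ = {a | ¬ ∃ k, a k = x} := rfl
  have h5 := one_add_mul_le_pow (a := -p x) (by linarith) N
  rw [h4, h3] at h2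
  rw [← sub_eq_add_neg] at h5
  linarith

/-- Chernoff's method with parameter `η / 2`: the indicator is dominated by an exponential, which
factorises over the samples, and `e^u ≤ 1 + u + u²` for `|u| ≤ 1` bounds each factor. -/
theorem weight_iidProb_sum_ge_le {N : ℕ} {p : Ω → ℝ} (hp0 : ∀ ω, 0 ≤ p ω)
    (hp : ∑ ω, p ω = 1) {Z : Ω → ℝ} (hZ : ∀ ω, |Z ω| ≤ 1) {η : ℝ} (hη0 : 0 ≤ η) (hη1 : η ≤ 1) :
    weight (iidProb N p) {b | N * η ≤ ∑ k, Z (b k) - N * ∑ ω, p ω * Z ω}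
      ≤ Real.exp (-(N * (η ^ 2 / 4))) := by
  set μ := ∑ ω, p ω * Z ω with hμ
  have h1 : ∀ b, {b : Fin N → Ω | N * η ≤ ∑ k, Z (b k) - N * μ}.indicator (iidProb N p) b
      ≤ ∏ k, p (b k) * Real.exp (η / 2 * (Z (b k) - μ - η)) := by
    intro b
    rw [Finset.prod_mul_distrib, ← Real.exp_sum]
    have h0 := iidProb_nonneg (N := N) hp0 b
    by_cases hb : N * η ≤ ∑ k, Z (b k) - N * μ
    · rw [Set.indicator_of_mem (by exact hb)]
      refine le_mul_of_one_le_right h0 (Real.one_le_exp ?_)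
      rw [← Finset.mul_sum]
      refine mul_nonneg (by linarith) ?_
      simp only [Finset.sum_sub_distrib, Finset.sum_const, Finset.card_univ, Fintype.card_fin,
        nsmul_eq_mul]
      linarith
    · rw [Set.indicator_of_notMem (by exact hb)]
      exact mul_nonneg h0 (Real.exp_pos _).le
  refine (Finset.sum_le_sum fun b _ => h1 b).trans ?_
  rw [sum_pi_prod (fun _ ω => p ω * Real.exp (η / 2 * (Z ω - μ - η))), Finset.prod_const,
    Finset.card_univ, Fintype.card_fin, ← mul_neg, Real.exp_nat_mul]
  refine pow_le_pow_left₀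
    (Finset.sum_nonneg fun ω _ => mul_nonneg (hp0 ω) (Real.exp_pos _).le) ?_ N
  have h2 : ∀ ω, Real.exp (η / 2 * Z ω) ≤ 1 + η / 2 * Z ω + η ^ 2 / 4 := by
    intro ω
    have hz : |η / 2 * Z ω| ≤ η / 2 := by
      rw [abs_mul, abs_of_nonneg (by linarith : 0 ≤ η / 2)]
      exact mul_le_of_le_one_right (by linarith) (hZ ω)
    have h3 := Real.abs_exp_sub_one_sub_id_le (x := η / 2 * Z ω) (by linarith)
    have h4 : (η / 2 * Z ω) ^ 2 ≤ (η / 2) ^ 2 := sq_le_sq' (abs_le.mp hz).1 (abs_le.mp hz).2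
    have h5 := (abs_le.mp h3).2
    nlinarith
  calc ∑ ω, p ω * Real.exp (η / 2 * (Z ω - μ - η))
      = (∑ ω, p ω * Real.exp (η / 2 * Z ω)) * Real.exp (-(η / 2 * (μ + η))) := by
        rw [Finset.sum_mul]
        refine Finset.sum_congr rfl fun ω _ => ?_
        rw [mul_assoc, ← Real.exp_add]
        congr 2
        ring
    _ ≤ (∑ ω, p ω * (1 + η / 2 * Z ω + η ^ 2 / 4)) * Real.exp (-(η / 2 * (μ + η))) := by
        refine mul_le_mul_of_nonneg_right (Finset.sum_le_sum fun ω _ => ?_) (Real.exp_pos _).le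
        exact mul_le_mul_of_nonneg_left (h2 ω) (hp0 ω)
    _ = (η / 2 * μ + η ^ 2 / 4 + 1) * Real.exp (-(η / 2 * (μ + η))) := by
        congr 1
        have : ∀ ω, p ω * (1 + η / 2 * Z ω + η ^ 2 / 4)
            = (1 + η ^ 2 / 4) * p ω + η / 2 * (p ω * Z ω) := fun ω => by ring
        simp_rw [this]
        rw [Finset.sum_add_distrib, ← Finset.mul_sum, ← Finset.mul_sum, hp, ← hμ]
        ring
    _ ≤ Real.exp (η / 2 * μ + η ^ 2 / 4) * Real.exp (-(η / 2 * (μ + η))) :=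
        mul_le_mul_of_nonneg_right (Real.add_one_le_exp _) (Real.exp_pos _).le
    _ = Real.exp (-(η ^ 2 / 4)) := by
        rw [← Real.exp_add]
        congr 1
        ring

theorem weight_iidProb_abs_sum_ge_le {N : ℕ} {p : Ω → ℝ} (hp0 : ∀ ω, 0 ≤ p ω)
    (hp : ∑ ω, p ω = 1) {Z : Ω → ℝ} (hZ : ∀ ω, |Z ω| ≤ 1) {η : ℝ} (hη0 : 0 ≤ η) (hη1 : η ≤ 1) :
    weight (iidProb N p) {b | N * η ≤ |∑ k, Z (b k) - N * ∑ ω, p ω * Z ω|}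
      ≤ 2 * Real.exp (-(N * (η ^ 2 / 4))) := by
  have h1 := weight_iidProb_sum_ge_le (N := N) hp0 hp hZ hη0 hη1
  have h2 := weight_iidProb_sum_ge_le (N := N) (Z := fun ω => -Z ω) hp0 hp
    (by simpa using hZ) hη0 hη1
  rw [two_mul]
  refine (weight_mono (iidProb_nonneg hp0) ?_).trans
    ((weight_union_le (iidProb_nonneg hp0) _ _).trans (add_le_add h1 h2))
  intro b hb
  have hb' : N * η ≤ |∑ k, Z (b k) - N * ∑ ω, p ω * Z ω| := hb
  rcases le_abs.mp hb' with h | h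
  · exact Or.inl h
  · refine Or.inr ?_
    simp only [Set.mem_ofPred_eq, Finset.sum_neg_distrib, mul_neg]
    linarith

/-- The failure probability of a two-stage scheme: samples from `p` reveal the labels of large
weight, and independent samples from `q` estimate a mean for every revealed label. -/
theorem weight_two_stage_le {N : ℕ} {p : Ω → ℝ} {q : Ω' → ℝ} (hp0 : ∀ ω, 0 ≤ p ω)
    (hp : ∑ ω, p ω = 1) (hq0 : ∀ ω, 0 ≤ q ω) (hq : ∑ ω, q ω = 1) {Z : Ω → Ω' → ℝ}
    (hZ : ∀ x ω, |Z x ω| ≤ 1) {η τ : ℝ} (hη0 : 0 ≤ η) (hη1 : η ≤ 1) (S : Finset Ω) :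
    weight (fun z : (Fin N → Ω) × (Fin N → Ω') => iidProb N p z.1 * iidProb N q z.2)
      {z | ¬ ((∀ x ∈ S, τ ≤ p x → ∃ k, z.1 k = x) ∧
        ∀ x, (∃ k, z.1 k = x) → |∑ k, Z x (z.2 k) - N * ∑ ω, q ω * Z x ω| < N * η)}
      ≤ S.card * Real.exp (-(N * τ)) + 2 * N * Real.exp (-(N * (η ^ 2 / 4))) := by
  classical
  have hw0 : ∀ z : (Fin N → Ω) × (Fin N → Ω'), 0 ≤ iidProb N p z.1 * iidProb N q z.2 :=
    fun z => mul_nonneg (iidProb_nonneg hp0 _) (iidProb_nonneg hq0 _)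
  let E : Ω → Set ((Fin N → Ω) × (Fin N → Ω')) := fun x => {a | ¬ ∃ k, a k = x} ×ˢ Set.univ
  let F : Ω → Set ((Fin N → Ω) × (Fin N → Ω')) := fun x =>
    {a | ∃ k, a k = x} ×ˢ {b | N * η ≤ |∑ k, Z x (b k) - N * ∑ ω, q ω * Z x ω|}
  have hsub : {z : (Fin N → Ω) × (Fin N → Ω') |
      ¬ ((∀ x ∈ S, τ ≤ p x → ∃ k, z.1 k = x) ∧
        ∀ x, (∃ k, z.1 k = x) → |∑ k, Z x (z.2 k) - N * ∑ ω, q ω * Z x ω| < N * η)}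
      ⊆ (⋃ x ∈ S.filter (fun x => τ ≤ p x), E x) ∪ ⋃ x ∈ Finset.univ, F x := by
    intro z hz
    rw [Set.mem_ofPred_eq, not_and_or] at hz
    rcases hz with h | h
    · push Not at h
      obtain ⟨x, hxS, hx, hk⟩ := h
      refine Or.inl (Set.mem_biUnion (x := x) (by simpa using ⟨hxS, hx⟩) ?_)
      simpa [E] using hk
    · push Not at h
      obtain ⟨x, hk, hx⟩ := h
      exact Or.inr (Set.mem_biUnion (x := x) (by simp) ⟨hk, hx⟩)
  refine (weight_mono hw0 hsub).trans ((weight_union_le hw0 _ _).trans (add_le_add ?_ ?_))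
  · refine (weight_biUnion_le hw0 _ _).trans ?_
    refine (Finset.sum_le_card_nsmul _ _ (Real.exp (-(N * τ))) fun x hx => ?_).trans ?_
    · have h1 : weight (iidProb N q) Set.univ = 1 := by simp [weight, sum_iidProb hq]
      rw [weight_prod (iidProb N p) (iidProb N q), h1, mul_one]
      refine (weight_iidProb_unseen_le hp0 hp x).trans (Real.exp_le_exp.mpr ?_)
      have := (Finset.mem_filter.mp hx).2
      gcongr
    · rw [nsmul_eq_mul]
      gcongr
      exact Finset.filter_subset _ _
  · refine (weight_biUnion_le hw0 _ _).trans ?_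
    -- Independence of the two stages: the chance that `x` is seen and its mean is bad is at most `N
    -- * p x` times the tail bound. Summed against `∑ p = 1`, this does not depend on the number of
    -- labels.
    have h2 : ∀ x ∈ Finset.univ,
        weight (fun z : (Fin N → Ω) × (Fin N → Ω') => iidProb N p z.1 * iidProb N q z.2) (F x)
          ≤ p x * (2 * N * Real.exp (-(N * (η ^ 2 / 4)))) := by
      intro x _
      rw [weight_prod (iidProb N p) (iidProb N q)]
      refine (mul_le_mul (weight_iidProb_seen_le hp0 hp x)
        (weight_iidProb_abs_sum_ge_le hq0 hq (hZ x) hη0 hη1)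
        (Finset.sum_nonneg fun b _ => Set.indicator_nonneg (fun b _ => iidProb_nonneg hq0 b) b)
        (mul_nonneg (Nat.cast_nonneg _) (hp0 x))).trans (le_of_eq (by ring))
    refine (Finset.sum_le_sum h2).trans (le_of_eq ?_)
    rw [← Finset.sum_mul, hp, one_mul]

end Weight

/-! ### Product measurements from tight frames -/

/-- The rank one operators `|u_ω⟩⟨u_ω|` sum to the identity. -/
def IsTightFrame {ι Ω : Type*} [Fintype Ω] [DecidableEq ι] (u : Ω → ι → ℂ) : Prop :=
  ∀ i j, ∑ ω, u ω i * star (u ω j) = if i = j then 1 else 0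

/-- The measurement with rank one effects `|u_ω⟩⟨u_ω|`. -/
def IsTightFrame.povm {ι Ω : Type} [Fintype ι] [DecidableEq ι] [Fintype Ω] {u : Ω → ι → ℂ}
    (hu : IsTightFrame u) : POVM ι Ω where
  effect ω := Matrix.vecMulVec (u ω) (star (u ω))
  posSemidef ω := Matrix.posSemidef_vecMulVec_self_star (u ω)
  sum_eq_one := by
    ext i j
    rw [Matrix.sum_apply, Matrix.one_apply, ← hu i j]
    rfl

theorem IsTightFrame.bornProb_povm {ι Ω : Type} [Fintype ι] [DecidableEq ι] [Fintype Ω]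
    {u : Ω → ι → ℂ} (hu : IsTightFrame u) (φ : ι → ℂ) (ω : Ω) :
    hu.povm.bornProb φ ω = ‖star (u ω) ⬝ᵥ φ‖ ^ 2 := by
  have h : star φ ⬝ᵥ (Matrix.vecMulVec (u ω) (star (u ω)) *ᵥ φ)
      = ((‖star (u ω) ⬝ᵥ φ‖ ^ 2 : ℝ) : ℂ) := by
    have h1 : star φ ⬝ᵥ u ω = star (star (u ω) ⬝ᵥ φ) := by
      rw [Matrix.star_dotProduct]
    rw [Matrix.vecMulVec_mulVec, op_smul_eq_smul, dotProduct_smul, h1, smul_eq_mul,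
      Complex.star_def, Complex.mul_conj']
    push_cast
    rfl
  change (star φ ⬝ᵥ (Matrix.vecMulVec (u ω) (star (u ω)) *ᵥ φ)).re = _
  rw [h, Complex.ofReal_re]

/-- The tensor product of `N` vectors from the family `u` and `M` vectors from the family `v`. -/
def blockVec {ι Ω Ω' : Type*} {N M : ℕ} (u : Ω → ι → ℂ) (v : Ω' → ι → ℂ)
    (z : (Fin N → Ω) × (Fin M → Ω')) (i : Fin (N + M) → ι) : ℂ :=
  (∏ k, u (z.1 k) (i (Fin.castAdd M k))) * ∏ k, v (z.2 k) (i (Fin.natAdd N k))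

theorem IsTightFrame.blockVec {ι Ω Ω' : Type*} [DecidableEq ι] [Fintype Ω] [Fintype Ω']
    {N M : ℕ} {u : Ω → ι → ℂ} {v : Ω' → ι → ℂ} (hu : IsTightFrame u) (hv : IsTightFrame v) :
    IsTightFrame (blockVec (N := N) (M := M) u v) := by
  intro i j
  have h : ∀ (a : Fin N → Ω) (b : Fin M → Ω'),
      _root_.blockVec u v (a, b) i * star (_root_.blockVec u v (a, b) j)
      = (∏ k, u (a k) (i (Fin.castAdd M k)) * star (u (a k) (j (Fin.castAdd M k)))) *
        ∏ k, v (b k) (i (Fin.natAdd N k)) * star (v (b k) (j (Fin.natAdd N k))) := by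
    intro a b
    simp only [_root_.blockVec, star_mul', star_prod, Finset.prod_mul_distrib]
    ring
  rw [Fintype.sum_prod_type]
  simp_rw [h, ← Finset.mul_sum, ← Finset.sum_mul]
  rw [sum_pi_prod (fun k ω => u ω (i (Fin.castAdd M k)) * star (u ω (j (Fin.castAdd M k)))),
    sum_pi_prod (fun k ω => v ω (i (Fin.natAdd N k)) * star (v ω (j (Fin.natAdd N k))))]
  simp_rw [hu _ _, hv _ _]
  rw [← Fin.prod_univ_add (fun k => if i k = j k then (1 : ℂ) else 0), Finset.prod_ite_zero]
  simp [funext_iff]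

/-- Overlaps of product vectors factorise, so the outcomes on the copies are independent. -/
theorem star_blockVec_dotProduct_copies {ι Ω Ω' : Type} [Fintype ι] {N M : ℕ} (u : Ω → ι → ℂ)
    (v : Ω' → ι → ℂ) (z : (Fin N → Ω) × (Fin M → Ω')) (φ : ι → ℂ) :
    star (blockVec u v z) ⬝ᵥ copies (N + M) φ
      = (∏ k, star (u (z.1 k)) ⬝ᵥ φ) * ∏ k, star (v (z.2 k)) ⬝ᵥ φ := by
  classical
  simp only [dotProduct]
  rw [← (Fin.appendEquiv N M).sum_comp, Fintype.sum_prod_type, Finset.prod_univ_sum,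
    Finset.prod_univ_sum, Fintype.piFinset_univ, Fintype.piFinset_univ, Finset.sum_mul_sum]
  refine Finset.sum_congr rfl fun i _ => Finset.sum_congr rfl fun j _ => ?_
  simp only [Pi.star_apply, blockVec, copies, Fin.appendEquiv, Equiv.coe_fn_mk, Fin.append_left,
    Fin.append_right, Fin.prod_univ_add, star_mul', star_prod, Finset.prod_mul_distrib]
  ring

theorem isTightFrame_single {X : Type*} [Fintype X] [DecidableEq X] :
    IsTightFrame (fun x : X => (Pi.single x 1 : X → ℂ)) := by
  intro i j
  simp [Pi.single_apply, apply_ite star]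

/-- The phase vectors, normalised to a tight frame. -/
def phaseFrame {X : Type*} [Fintype X] [DecidableEq X] (w : X → ZMod 4) : X → ℂ :=
  (((Real.sqrt (Fintype.card (X → ZMod 4)))⁻¹ : ℝ) : ℂ) • phaseVec w

theorem isTightFrame_phaseFrame {X : Type*} [Fintype X] [DecidableEq X] :
    IsTightFrame (phaseFrame (X := X)) := by
  intro i j
  have hc : (Fintype.card (X → ZMod 4) : ℂ) ≠ 0 := Nat.cast_ne_zero.mpr Fintype.card_ne_zero
  have hs : (((Real.sqrt (Fintype.card (X → ZMod 4)))⁻¹ : ℝ) : ℂ) *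
      (((Real.sqrt (Fintype.card (X → ZMod 4)))⁻¹ : ℝ) : ℂ)
      = (Fintype.card (X → ZMod 4) : ℂ)⁻¹ := by
    rw [← Complex.ofReal_mul, ← mul_inv, Real.mul_self_sqrt (by positivity)]
    push_cast
    rfl
  have h : ∀ w : X → ZMod 4, phaseFrame w i * star (phaseFrame w j)
      = (Fintype.card (X → ZMod 4) : ℂ)⁻¹ * (phaseVec w i * star (phaseVec w j)) := by
    intro w
    rw [← hs]
    simp only [phaseFrame, Pi.smul_apply, smul_eq_mul, star_mul', Complex.star_def,
      Complex.conj_ofReal]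
    ring
  simp_rw [h]
  rw [← Finset.mul_sum, sum_phaseVec_mul_star]
  split_ifs
  · exact inv_mul_cancel₀ hc
  · exact mul_zero _

theorem norm_star_phaseFrame_dotProduct {X : Type*} [Fintype X] [DecidableEq X]
    (w : X → ZMod 4) (β : X → ℂ) :
    ‖star (phaseFrame w) ⬝ᵥ β‖ ^ 2 = phaseProb β w := by
  have h : star (phaseFrame w)
      = (((Real.sqrt (Fintype.card (X → ZMod 4)))⁻¹ : ℝ) : ℂ) • star (phaseVec w) := by
    rw [phaseFrame, star_smul, Complex.star_def, Complex.conj_ofReal]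
  rw [h, smul_dotProduct, norm_smul, mul_pow, Complex.norm_real, Real.norm_eq_abs, sq_abs,
    inv_pow, Real.sq_sqrt (by positivity), phaseProb]
  ring

/-- The measurement of `N` copies in the computational basis and of `N` further copies with the
phase vectors. -/
def blockMeasurement (X : Type) [Fintype X] [DecidableEq X] (N : ℕ) :
    POVM (Fin (N + N) → X) ((Fin N → X) × (Fin N → X → ZMod 4)) :=
  (isTightFrame_single.blockVec isTightFrame_phaseFrame).povm

theorem bornProb_blockMeasurement {X : Type} [Fintype X] [DecidableEq X] (N : ℕ) (β : X → ℂ)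
    (z : (Fin N → X) × (Fin N → X → ZMod 4)) :
    (blockMeasurement X N).bornProb (copies (N + N) β) z
      = iidProb N (fun x => ‖β x‖ ^ 2) z.1 * iidProb N (phaseProb β) z.2 := by
  rw [blockMeasurement, IsTightFrame.bornProb_povm, star_blockVec_dotProduct_copies, norm_mul,
    norm_prod, norm_prod, mul_pow, ← Finset.prod_pow, ← Finset.prod_pow]
  simp_rw [norm_star_phaseFrame_dotProduct]
  have h : ∀ x : X, star (Pi.single x (1 : ℂ) : X → ℂ) ⬝ᵥ β = β x := by
    intro x
    simp
  simp_rw [h]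
  rfl

/-! ### The threshold learner and its accuracy -/

/-- The empirical mean of the estimators `Im (w_x * conj w_0)` of `Im β_x`. -/
def phaseMean {n N : ℕ} (b : Fin N → PauliLabel n → ZMod 4) (x : PauliLabel n) : ℝ :=
  (∑ k, (phaseVec (b k) x * star (phaseVec (b k) (zeroLabel n))).im) / N

open Classical in
/-- The estimate of the amplitudes: the amplitude at `0` is taken to be `1`, the others to be
imaginary, and to vanish unless they were seen in the computational basis and their estimate
exceeds the threshold `θ`. -/
def thresholdAmplitudes {n N : ℕ} (θ : ℝ)
    (z : (Fin N → PauliLabel n) × (Fin N → PauliLabel n → ZMod 4)) (x : PauliLabel n) : ℂ :=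
  if x = zeroLabel n then 1
  else if (∃ k, z.1 k = x) ∧ θ < |phaseMean z.2 x| then Complex.I * phaseMean z.2 x
  else 0

/-- The learner that measures `N` copies in the computational basis and `N` copies with the phase
vectors, and thresholds the estimated amplitudes. -/
def thresholdLearner (n N : ℕ) (t θ : ℝ) (ht : 0 < t) : TomographyLearner n where
  time := t
  time_pos := ht
  numCopies := N + N
  Outcome := (Fin N → PauliLabel n) × (Fin N → PauliLabel n → ZMod 4)
  measurement := blockMeasurement (PauliLabel n) N
  amplitudes := thresholdAmplitudes θ

namespace TomographyLearner

variable {n : ℕ} (L : TomographyLearner n) (ω : L.Outcome)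

theorem estimate_isHermitian : (L.estimate ω).IsHermitian := by
  unfold estimate
  rw [Matrix.IsHermitian, Matrix.conjTranspose_sum]
  refine Finset.sum_congr rfl fun x _ => ?_
  rw [Matrix.conjTranspose_smul, (pauli_isHermitian x).eq, Complex.star_def, Complex.conj_ofReal]

theorem pauliCoeff_estimate (x : PauliLabel n) :
    pauliCoeff (L.estimate ω) x
      = if x = zeroLabel n then 0 else ((-(L.amplitudes ω x).im / L.time : ℝ) : ℂ) := by
  rw [estimate, pauliCoeff_sum]
  simp_rw [pauliCoeff_smul, pauliCoeff_pauli]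
  simp only [mul_ite, mul_one, mul_zero, Finset.sum_ite_eq, Finset.mem_erase, Finset.mem_univ,
    and_true, ite_not, ne_eq]

theorem trace_estimate : (L.estimate ω).trace = 0 := by
  have h := L.pauliCoeff_estimate ω (zeroLabel n)
  rw [if_pos rfl, pauliCoeff, pauli_zeroLabel, one_mul, div_eq_zero_iff] at h
  exact h.resolve_right (by positivity)

end TomographyLearner

theorem pauliCoeff_zeroLabel_of_trace_eq_zero {n : ℕ} {A : Matrix (Qubits n) (Qubits n) ℂ}
    (hA : A.trace = 0) : pauliCoeff A (zeroLabel n) = 0 := by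
  rw [pauliCoeff, pauli_zeroLabel, one_mul, hA, zero_div]

/-- Accuracy of the thresholded estimate of a single amplitude `β`, whose first-order
approximation is `-i a` with `a` real; `β₀` is the amplitude of the identity. -/
theorem abs_threshold_sub_le {β β₀ : ℂ} {a y r : ℝ} (hβ : ‖β - (-(Complex.I * a))‖ ≤ 6 / 10 * r)
    (hβ1 : ‖β‖ ≤ 1) (hβ₀ : ‖β₀ - 1‖ ≤ 6 / 10 * r)
    (hy : |y - (β * star β₀).im| < 3 / 10 * r) :
    |y - β.im| ≤ 9 / 10 * r ∧ |β.im + a| ≤ 6 / 10 * r ∧ |β.re| ≤ 6 / 10 * r := by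
  -- Replacing `β₀` by `1` costs at most `|β| |β₀ - 1|`; with the statistical error `0.3 r` this
  -- makes `0.9 r`.
  have h1 : |(β * star β₀).im - β.im| ≤ 6 / 10 * r := by
    have h : (β * star β₀).im - β.im = (β * star (β₀ - 1)).im := by
      simp [mul_sub]
    rw [h]
    refine (Complex.abs_im_le_norm _).trans ?_
    rw [norm_mul, norm_star]
    exact (mul_le_of_le_one_left (norm_nonneg _) hβ1).trans hβ₀
  refine ⟨?_, ?_, ?_⟩
  · have := abs_add_le (y - (β * star β₀).im) ((β * star β₀).im - β.im)
    rw [sub_add_sub_cancel] at this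
    linarith
  · refine le_trans (le_of_eq ?_) ((Complex.abs_im_le_norm _).trans hβ)
    simp
  · refine le_trans (le_of_eq ?_) ((Complex.abs_re_le_norm _).trans hβ)
    simp

theorem thresholdLearner_accurate {n N m : ℕ} {ε t r : ℝ} (ht : 0 < t)
    (hr : 0 < r) (hrε : 4 * r ≤ t * (ε / 8))
    {A : Matrix (Qubits n) (Qubits n) ℂ} (hA : A.IsHermitian) (htr : A.trace = 0)
    (hm : pauliSparsity A ≤ m)
    (happ : ∀ x, ‖evolvedState A t x -
        ((if x = zeroLabel n then 1 else 0) - Complex.I * t * pauliCoeff A x)‖ ≤ 6 / 10 * r)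
    {z : (Fin N → PauliLabel n) × (Fin N → PauliLabel n → ZMod 4)}
    (hseen : ∀ x, pauliCoeff A x ≠ 0 → r ^ 2 ≤ ‖evolvedState A t x‖ ^ 2 → ∃ k, z.1 k = x)
    (hmean : ∀ x, x ≠ zeroLabel n → (∃ k, z.1 k = x) →
      |phaseMean z.2 x - (evolvedState A t x * star (evolvedState A t (zeroLabel n))).im|
        < 3 / 10 * r) :
    let L := thresholdLearner n N t (3 / 2 * r) ht
    (∀ x, ‖L.amplitudes z x - evolvedState A t x‖ ≤ 3 * r) ∧
      pauliSparsity (L.estimate z) ≤ m ∧ pauliNormInf (A - L.estimate z) ≤ ε / 8 := by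
  intro L
  set β := evolvedState A t with hβdef
  have hβ₀ : ‖β (zeroLabel n) - 1‖ ≤ 6 / 10 * r := by
    simpa [pauliCoeff_zeroLabel_of_trace_eq_zero htr] using happ (zeroLabel n)
  have hβ1 : ∀ x, ‖β x‖ ≤ 1 := by
    intro x
    have h := Finset.single_le_sum (f := fun x => ‖β x‖ ^ 2) (fun x _ => sq_nonneg _)
      (Finset.mem_univ x)
    rw [sum_normSq_evolvedState hA] at h
    exact (sq_le_one_iff₀ (norm_nonneg _)).mp h
  have hre : ∀ x, pauliCoeff A x = ((pauliCoeff A x).re : ℂ) := fun x =>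
    Complex.ext (by simp) (by simp [pauliCoeff_im hA])
  have happ' : ∀ x, x ≠ zeroLabel n →
      ‖β x - (-(Complex.I * ((t * (pauliCoeff A x).re : ℝ) : ℂ)))‖ ≤ 6 / 10 * r := by
    intro x hx
    have h := happ x
    rw [if_neg hx, zero_sub] at h
    rw [Complex.ofReal_mul, ← hre, ← mul_assoc]
    exact h
  have key : ∀ x, x ≠ zeroLabel n → ∃ g : ℝ, L.amplitudes z x = Complex.I * g ∧
      |g - (β x).im| ≤ 24 / 10 * r ∧ |(β x).re| ≤ 6 / 10 * r ∧
      |(β x).im + t * (pauliCoeff A x).re| ≤ 6 / 10 * r ∧ (pauliCoeff A x = 0 → g = 0) := by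
    intro x hx
    have hamp : L.amplitudes z x = if (∃ k, z.1 k = x) ∧ 3 / 2 * r < |phaseMean z.2 x|
        then Complex.I * phaseMean z.2 x else 0 := by
      change thresholdAmplitudes _ _ _ = _
      rw [thresholdAmplitudes, if_neg hx]
    rw [hamp]
    by_cases hs : ∃ k, z.1 k = x
    · obtain ⟨h1, h2, h3⟩ := abs_threshold_sub_le (happ' x hx) (hβ1 x) hβ₀ (hmean x hx hs)
      by_cases hθ : 3 / 2 * r < |phaseMean z.2 x|
      · refine ⟨phaseMean z.2 x, by rw [if_pos ⟨hs, hθ⟩], by linarith, h3, h2, fun h0 => ?_⟩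
        -- If the coefficient vanishes, the mean is at most `0.9 r + 0.6 r`, which does not exceed
        -- the threshold `1.5 r`.
        rw [h0, Complex.zero_re, mul_zero, add_zero] at h2
        have := abs_add_le (phaseMean z.2 x - (β x).im) (β x).im
        rw [sub_add_cancel] at this
        linarith
      · refine ⟨0, by rw [if_neg (fun h => hθ h.2)]; simp, ?_, h3, h2, fun _ => rfl⟩
        -- Zeroing a mean below the threshold gives an error of at most `1.5 r + 0.9 r = 2.4 r`.
        have := abs_add_le (phaseMean z.2 x) (-(phaseMean z.2 x - (β x).im))
        rw [abs_neg] at this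
        rw [zero_sub, abs_neg]
        rw [show phaseMean z.2 x + -(phaseMean z.2 x - (β x).im) = (β x).im by ring] at this
        linarith
    -- For an unseen label only the bounds not involving the mean are needed, so the exact mean is
    -- substituted for it.
    · have hmu : |(β x * star (β (zeroLabel n))).im - (β x * star (β (zeroLabel n))).im|
          < 3 / 10 * r := by
        rw [sub_self, abs_zero]
        linarith
      obtain ⟨-, h2, h3⟩ := abs_threshold_sub_le (happ' x hx) (hβ1 x) hβ₀ hmu
      refine ⟨0, by rw [if_neg (fun h => hs h.1)]; simp, ?_, h3, h2, fun _ => rfl⟩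
      rw [zero_sub, abs_neg]
      by_cases h0 : pauliCoeff A x = 0
      · rw [h0, Complex.zero_re, mul_zero, add_zero] at h2
        linarith
      · have hlt : ‖β x‖ < r := by
          by_contra hge
          exact hs (hseen x h0 (pow_le_pow_left₀ hr.le (not_lt.mp hge) 2))
        have := Complex.abs_im_le_norm (β x)
        linarith
  have hest := L.pauliCoeff_estimate z
  refine ⟨fun x => ?_, ?_, ?_⟩
  · by_cases hx : x = zeroLabel n
    · have hamp : L.amplitudes z x = 1 := by
        change thresholdAmplitudes _ _ _ = _
        rw [thresholdAmplitudes, if_pos hx]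
      rw [hamp, hx, norm_sub_rev]
      linarith
    · obtain ⟨g, hg, h1, h2, -, -⟩ := key x hx
      rw [hg]
      -- The estimate is purely imaginary: `0.6 r` from the real part and `2.4 r` from the imaginary
      -- part.
      refine (Complex.norm_le_abs_re_add_abs_im _).trans ?_
      have hre' : (Complex.I * (g : ℂ) - β x).re = -(β x).re := by simp
      have him' : (Complex.I * (g : ℂ) - β x).im = g - (β x).im := by simp
      rw [hre', him', abs_neg]
      linarith
  · refine le_trans (Set.ncard_le_ncard (fun x hx => ?_) (Set.toFinite _)) hm
    rw [Set.mem_ofPred_eq, hest x] at hx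
    rw [Set.mem_ofPred_eq]
    by_cases hx0 : x = zeroLabel n
    · rw [if_pos hx0] at hx
      exact absurd rfl hx
    · rw [if_neg hx0] at hx
      obtain ⟨g, hg, -, -, -, h0⟩ := key x hx0
      intro h
      rw [hg, h0 h] at hx
      simp at hx
  · refine Finset.sup'_le _ _ fun x _ => ?_
    rw [pauliCoeff_sub, hest x]
    by_cases hx0 : x = zeroLabel n
    · rw [if_pos hx0, hx0, pauliCoeff_zeroLabel_of_trace_eq_zero htr, sub_zero, norm_zero]
      have : 0 ≤ t * (ε / 8) := by linarith
      exact nonneg_of_mul_nonneg_right this ht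
    · rw [if_neg hx0]
      obtain ⟨g, hg, h1, -, h3, -⟩ := key x hx0
      have himg : (L.amplitudes z x).im = g := by simp [hg]
      have htime : L.time = t := rfl
      rw [himg, htime, hre x, ← Complex.ofReal_sub, Complex.norm_real, Real.norm_eq_abs]
      -- Expansion error `0.6 r` plus estimation error `2.4 r`, below `4 r`.
      have h4 : |t * (pauliCoeff A x).re + g| ≤ t * (ε / 8) := by
        have := abs_add_le ((β x).im + t * (pauliCoeff A x).re) (g - (β x).im)
        rw [show (β x).im + t * (pauliCoeff A x).re + (g - (β x).im)
          = t * (pauliCoeff A x).re + g by ring] at this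
        linarith
      rw [show (pauliCoeff A x).re - -g / t = (t * (pauliCoeff A x).re + g) / t by
        field_simp
        ring, abs_div, abs_of_pos ht, div_le_iff₀ ht]
      linarith

theorem thresholdLearner_prob_ge {n N m : ℕ} {ε t r : ℝ} (ht : 0 < t)
    (hN : 0 < N) (hr : 0 < r) (hr1 : r ≤ 1) (hrε : 4 * r ≤ t * (ε / 8))
    {A : Matrix (Qubits n) (Qubits n) ℂ} (hA : A.IsHermitian) (htr : A.trace = 0)
    (hm : pauliSparsity A ≤ m)
    (happ : ∀ x, ‖evolvedState A t x -
        ((if x = zeroLabel n then 1 else 0) - Complex.I * t * pauliCoeff A x)‖ ≤ 6 / 10 * r) :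
    let L := thresholdLearner n N t (3 / 2 * r) ht
    1 - (m * Real.exp (-(N * r ^ 2)) + 2 * N * Real.exp (-(N * ((3 / 10 * r) ^ 2 / 4))))
      ≤ L.prob A {ω | (∀ x, ‖L.amplitudes ω x - evolvedState A L.time x‖ ≤ 3 * r) ∧
          (L.estimate ω).IsHermitian ∧ (L.estimate ω).trace = 0 ∧
          pauliSparsity (L.estimate ω) ≤ m ∧ pauliNormInf (A - L.estimate ω) ≤ ε / 8} := by
  classical
  intro L
  set β := evolvedState A t with hβ
  let p : PauliLabel n → ℝ := fun x => ‖β x‖ ^ 2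
  let W : (Fin N → PauliLabel n) × (Fin N → PauliLabel n → ZMod 4) → ℝ := fun z =>
    iidProb N p z.1 * iidProb N (phaseProb β) z.2
  let Z : PauliLabel n → (PauliLabel n → ZMod 4) → ℝ := fun x w =>
    (phaseVec w x * star (phaseVec w (zeroLabel n))).im
  -- Only support labels must be seen when heavy, so the first union bound has at most `m` terms.
  let S : Finset (PauliLabel n) := Finset.univ.filter fun x => pauliCoeff A x ≠ 0
  have hp0 : ∀ x, 0 ≤ p x := fun x => sq_nonneg _
  have hp : ∑ x, p x = 1 := sum_normSq_evolvedState hA t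
  have hq0 := phaseProb_nonneg β
  have hq : ∑ w, phaseProb β w = 1 := sum_phaseProb hp
  have hW0 : ∀ z, 0 ≤ W z := fun z => mul_nonneg (iidProb_nonneg hp0 _) (iidProb_nonneg hq0 _)
  have hW1 : ∑ z, W z = 1 := by
    rw [Fintype.sum_prod_type]
    simp only [W, ← Finset.mul_sum, sum_iidProb hq, mul_one, sum_iidProb hp]
  have hfail := weight_two_stage_le (N := N) hp0 hp hq0 hq (Z := Z) (η := 3 / 10 * r)
    (τ := r ^ 2) (fun x w => abs_im_phaseVec_le w x _) (by linarith) (by linarith) S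
  set G : Set ((Fin N → PauliLabel n) × (Fin N → PauliLabel n → ZMod 4)) :=
    {z | (∀ x ∈ S, r ^ 2 ≤ p x → ∃ k, z.1 k = x) ∧
      ∀ x, (∃ k, z.1 k = x) →
        |∑ k, Z x (z.2 k) - N * ∑ ω, phaseProb β ω * Z x ω| < N * (3 / 10 * r)} with hG
  have hGW : 1 - (S.card * Real.exp (-(N * r ^ 2)) +
      2 * N * Real.exp (-(N * ((3 / 10 * r) ^ 2 / 4)))) ≤ weight W G := by
    have h := weight_add_compl W G
    rw [hW1] at h
    have h2 : weight W Gᶜ ≤ _ := hfail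
    linarith
  have hS : (S.card : ℝ) ≤ m := by
    rw [pauliSparsity, Set.ncard_eq_toFinset_card'] at hm
    have : S.card ≤ m := by simpa [S] using hm
    exact_mod_cast this
  have hSm : S.card * Real.exp (-(N * r ^ 2)) ≤ m * Real.exp (-(N * r ^ 2)) := by gcongr
  have hprob : ∀ T : Set L.Outcome, L.prob A T = weight W T := by
    intro T
    have hb : L.measurement.bornProb (copies L.numCopies (evolvedState A L.time)) = W :=
      funext fun z => bornProb_blockMeasurement N β z
    rw [TomographyLearner.prob, hb]
    rfl
  rw [hprob]
  refine le_trans (by linarith) (hGW.trans (weight_mono hW0 ?_))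
  intro z hz
  obtain ⟨hz1, hz2⟩ := hz
  obtain ⟨h1, h2, h3⟩ := thresholdLearner_accurate (z := z) ht hr hrε hA htr hm happ
    (fun x hx h => hz1 x (by simpa [S] using hx) h) (fun x hx hk => by
      have h := hz2 x hk
      have hN' : (0 : ℝ) < N := Nat.cast_pos.mpr hN
      have hmu : ∑ ω, phaseProb β ω * Z x ω = (β x * star (β (zeroLabel n))).im :=
        sum_phaseProb_mul_im β hx
      rw [hmu] at h
      have h5 : phaseMean z.2 x - (β x * star (β (zeroLabel n))).im
          = (∑ k, Z x (z.2 k) - N * (β x * star (β (zeroLabel n))).im) / N := by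
        rw [sub_div, mul_div_cancel_left₀ _ hN'.ne']
        rfl
      rw [h5, abs_div, abs_of_pos hN', div_lt_iff₀ hN', mul_comm (3 / 10 * r)]
      exact h)
  exact ⟨h1, L.estimate_isHermitian z, L.trace_estimate z, h2, h3⟩

/-! ### Choice of parameters -/

/-- With `y = 2m/δ`, one has `N r² ≥ 5000 log y`, so the first term is at most `m / y`. In the
second, `5000 * 0.09 / 4 ≥ 100` gives a factor `y⁻¹ ^ 100`, which absorbs `N = O(y³)` and its
constant since `y ≥ 2`, leaving `1 / y`. The sum is at most `2m / y = δ`. -/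
theorem failure_bound_le {m N : ℕ} {δ r : ℝ} (hm : 1 ≤ m) (hδ : 0 < δ) (hδ1 : δ < 1)
    (hr : r = 1 / (1024 * m)) (hN : N = ⌈5000 * 2 ^ 20 * (m : ℝ) ^ 2 * Real.log (2 * m / δ)⌉₊) :
    m * Real.exp (-(N * r ^ 2)) + 2 * N * Real.exp (-(N * ((3 / 10 * r) ^ 2 / 4))) ≤ δ := by
  have hm1 : (1 : ℝ) ≤ m := by exact_mod_cast hm
  have hm0 : (0 : ℝ) < m := by linarith
  set y : ℝ := 2 * m / δ with hy
  have hy2 : 2 ≤ y := by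
    rw [hy, le_div_iff₀ hδ]
    nlinarith
  have hmy : (m : ℝ) ≤ y := by
    rw [hy, le_div_iff₀ hδ]
    nlinarith
  have hy0 : 0 < y := by linarith
  set l := Real.log y with hl
  have hl0 : 0 ≤ l := Real.log_nonneg (by linarith)
  have hly : l ≤ y := (Real.log_le_sub_one_of_pos hy0).trans (by linarith)
  have hδy : δ = 2 * m * y⁻¹ := by
    rw [hy]
    field_simp
  have hNge : 5000 * 2 ^ 20 * (m : ℝ) ^ 2 * l ≤ N := hN ▸ Nat.le_ceil _
  have hNle : (N : ℝ) ≤ 5000 * 2 ^ 20 * (m : ℝ) ^ 2 * l + 1 :=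
    hN ▸ (Nat.ceil_lt_add_one (by positivity)).le
  have hNr : 5000 * l ≤ N * r ^ 2 := by
    have h : 5000 * l = 5000 * 2 ^ 20 * (m : ℝ) ^ 2 * l * r ^ 2 := by
      rw [hr]
      field_simp
      norm_num
    rw [h]
    gcongr
  have hexp : ∀ k : ℕ, Real.exp (-(k * l)) = y⁻¹ ^ k := by
    intro k
    rw [← mul_neg, Real.exp_nat_mul, Real.exp_neg, hl, Real.exp_log hy0]
  have hu : y⁻¹ ≤ 1 / 2 := by
    rw [inv_eq_one_div]
    exact one_div_le_one_div_of_le two_pos hy2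
  have hu0 : 0 < y⁻¹ := inv_pos.mpr hy0
  have h1 : m * Real.exp (-(N * r ^ 2)) ≤ m * y⁻¹ := by
    gcongr
    calc Real.exp (-(N * r ^ 2)) ≤ Real.exp (-((1 : ℕ) * l)) := by
          refine Real.exp_le_exp.mpr (neg_le_neg ?_)
          push_cast
          linarith
      _ = y⁻¹ := by rw [hexp, pow_one]
  have h2 : Real.exp (-(N * ((3 / 10 * r) ^ 2 / 4))) ≤ y⁻¹ ^ 100 := by
    rw [← hexp]
    refine Real.exp_le_exp.mpr (neg_le_neg ?_)
    push_cast
    nlinarith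
  have hN3 : (N : ℝ) ≤ (5000 * 2 ^ 20 + 1) * y ^ 3 := by
    have h3 : (m : ℝ) ^ 2 * l ≤ y ^ 2 * y := by gcongr
    have h4 : 1 ≤ y ^ 3 := one_le_pow₀ (by linarith)
    nlinarith
  have h3 : 2 * N * Real.exp (-(N * ((3 / 10 * r) ^ 2 / 4))) ≤ y⁻¹ := by
    calc _ ≤ 2 * ((5000 * 2 ^ 20 + 1) * y ^ 3) * y⁻¹ ^ 100 := by gcongr
      _ = 2 * (5000 * 2 ^ 20 + 1) * y⁻¹ ^ 96 * y⁻¹ := by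
          have : y ^ 3 * y⁻¹ ^ 100 = y⁻¹ ^ 96 * y⁻¹ := by
            field_simp
          linear_combination 2 * (5000 * 2 ^ 20 + 1) * this
      _ ≤ 2 * (5000 * 2 ^ 20 + 1) * (1 / 2) ^ 96 * y⁻¹ := by gcongr
      _ ≤ 1 * y⁻¹ := by
          gcongr
          norm_num
      _ = y⁻¹ := one_mul _
  have h4 : y⁻¹ ≤ m * y⁻¹ := le_mul_of_one_le_left hu0.le hm1
  rw [hδy]
  linarith

end

theorem mainTheorem6 :
    ∃ C : ℝ, 0 < C ∧
      ∀ (n m : ℕ) (ε δ : ℝ), 1 ≤ m → 0 < ε → 0 < δ → δ < 1 →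
        ∃ L : TomographyLearner n,
          L.time = 1 / (32 * m * ε) ∧
          L.totalEvolutionTime ≤ C * (m ^ 2 / ε) * Real.log (2 * m / δ) ∧
          ∀ A : Matrix (Qubits n) (Qubits n) ℂ,
            A.IsHermitian → A.trace = 0 → pauliSparsity A ≤ m → pauliNormInf A ≤ ε →
              1 - δ ≤ L.prob A
                {ω | (∀ x, ‖L.amplitudes ω x - evolvedState A L.time x‖ ≤
                        3 * m * L.time ^ 2 * ε ^ 2) ∧
                      (L.estimate ω).IsHermitian ∧
                      (L.estimate ω).trace = 0 ∧
                      pauliSparsity (L.estimate ω) ≤ m ∧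
                      pauliNormInf (A - L.estimate ω) ≤ ε / 8} := by
  refine ⟨5000 * 2 ^ 20 + 2, by norm_num, fun n m ε δ hm hε hδ hδ1 => ?_⟩
  have hm1 : (1 : ℝ) ≤ m := by exact_mod_cast hm
  have hm0 : (0 : ℝ) < m := by linarith
  have hl : 1 / 2 ≤ Real.log (2 * m / δ) := by
    have h2 : (2 : ℝ) ≤ 2 * m / δ := by
      rw [le_div_iff₀ hδ]
      nlinarith
    have := Real.log_le_log two_pos h2
    have := Real.log_two_gt_d9
    linarith
  set l := Real.log (2 * m / δ) with hldef
  obtain ⟨N, hN⟩ : ∃ N, N = ⌈5000 * 2 ^ 20 * (m : ℝ) ^ 2 * l⌉₊ := ⟨_, rfl⟩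
  -- This is `m t² ε²`, because `t m ε = 1/32`; moreover `t ε = 32 r`, so the target `t ε / 8` is
  -- exactly `4 r`.
  obtain ⟨r, hr⟩ : ∃ r : ℝ, r = 1 / (1024 * m) := ⟨_, rfl⟩
  obtain ⟨t, ht⟩ : ∃ t : ℝ, t = 1 / (32 * m * ε) := ⟨_, rfl⟩
  have ht0 : 0 < t := by rw [ht]; positivity
  have hr0 : 0 < r := by rw [hr]; positivity
  have hN0 : 0 < N := by
    rw [hN, Nat.ceil_pos]
    have : 0 < l := by linarith
    positivity
  have hNle : (N : ℝ) ≤ 5000 * 2 ^ 20 * (m : ℝ) ^ 2 * l + 1 := by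
    rw [hN]
    refine (Nat.ceil_lt_add_one ?_).le
    have : 0 < l := by linarith
    positivity
  have hr1 : r ≤ 1 := by
    rw [hr, div_le_one (by positivity)]
    linarith
  have hts : t * (m * ε) = 1 / 32 := by
    rw [ht]
    field_simp
  have hacc : 3 * m * t ^ 2 * ε ^ 2 = 3 * r := by
    rw [ht, hr]
    field_simp
    norm_num
  have hrε : 4 * r ≤ t * (ε / 8) := by
    refine le_of_eq ?_
    rw [ht, hr]
    field_simp
    norm_num
  refine ⟨thresholdLearner n N t (3 / 2 * r) ht0, ht, ?_, fun A hA htr hsp hnorm => ?_⟩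
  · have htot : (thresholdLearner n N t (3 / 2 * r) ht0).totalEvolutionTime = (N + N : ℕ) * t := by
      change ∑ _k : Fin (N + N), t = _
      rw [Finset.sum_const, Finset.card_univ, Fintype.card_fin, nsmul_eq_mul]
    -- Since `m² l ≥ 1/2`, the rounding in `N` is absorbed by the extra 2 in the constant.
    have h1 : 1 ≤ 2 * ((m : ℝ) ^ 2 * l) := by nlinarith
    have h2 : (N : ℝ) ≤ (5000 * 2 ^ 20 + 2) * ((m : ℝ) ^ 2 * l) := by linarith
    have h3 : 2 * t ≤ 1 / ε := by
      rw [ht, mul_one_div]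
      rw [div_le_div_iff₀ (by positivity) hε]
      nlinarith
    rw [htot]
    push_cast
    calc ((N : ℝ) + N) * t = N * (2 * t) := by ring
      _ ≤ ((5000 * 2 ^ 20 + 2) * ((m : ℝ) ^ 2 * l)) * (1 / ε) := by gcongr
      _ = _ := by ring
  · have happ : ∀ x, ‖evolvedState A t x -
        ((if x = zeroLabel n then 1 else 0) - Complex.I * t * pauliCoeff A x)‖ ≤ 6 / 10 * r := by
      intro x
      refine (norm_evolvedState_sub_le hε.le ht0.le (by rw [hts]; norm_num) hsp hnorm x).trans ?_
      have hte : t * ε = 32 * r := by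
        rw [ht, hr]
        field_simp
        norm_num
      rw [hts, hte]
      linarith
    have h := thresholdLearner_prob_ge (N := N) ht0 hN0 hr0 hr1 hrε hA htr hsp happ
    have hfail := failure_bound_le hm hδ hδ1 hr hN
    rw [← hacc] at h
    exact le_trans (by linarith) h
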